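/- Let $\mathbb F\in\{\mathbb R,\mathbb C\}$ and let $(\mathbb X,\|\cdot\|)$ be a quasi-Banach space over $\mathbb F$. A renorming of $\mathbb X$ is a (not necessarily continuous) quasi-norm on $\mathbb X$ that induces the same topology. Let $\mathcal B=(x_n)_{n=1}^\infty$ be a complete Markushevich basis of $\mathbb X$, i.e. its linear span is dense and there are continuous linear functionals $x_n^*$ with $x_n^*(x_k)=\delta_{k,n}$. Write $\operatorname{supp}(f)=\{n: x_n^*(f)\neq 0\}$ and, for $A\subset\mathbb N$ finite, $S_A(f)=\sum_{n\in A}x_n^*(f)x_n$ and $S_{A^c}(f)=f-S_A(f)$. A set $A\subseteq\mathbb N$ is a greedy set of $f$ if $|x_k^*(f)|\le|x_n^*(f)|$ for all $n\in A$, $k\notin A$. Assuming that $\mathcal B$ is semi-normalized ($0<\inf_n\|x_n\|\le\sup_n\|x_n\|<\infty$) and $M$-bounded ($\sup_n\|x_n\|\,\|x_n^*\|<\infty$), the basis is called: * quasi-greedy if there is $C<\infty$ with $\|S_A(f)\|\le C\|f\|$ for all $f$ and all finite greedy sets $A$ of $f$; then $C_{qg}$ is the least $C$ with $\|S_{A\setminus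 B}(f)\|\le C\|f\|$ for all $f$ and all finite greedy sets $B\subseteq A$ of $f$; * almost greedy if there is $C<\infty$ with $\|f-S_A(f)\|\le C\|f-S_B(f)\|$ for all $f$, all finite greedy sets $A$ of $f$ and all $B\subset\mathbb N$ with $|B|\le|A|$; the least such $C$ is $C_{ag}$; * greedy if there is $C<\infty$ with $\|f-S_A(f)\|\le C\|f-z\|$ for all $f$, all finite greedy sets $A$ of $f$ and all $z\in\mathbb X$ with $|\operatorname{supp}(z)|\le|A|$; the least such $C$ is $C_g$. Put $\operatorname{sgn}(0)=1$, $\operatorname{sgn}(a)=a/|a|$ for $a\ne0$; for $A$ finite let $\mathcal U(f,A)=\min_{n\in A}|x_n^*(f)|\sum_{n\in A}\operatorname{sgn}(x_n^*(f))\,x_n$ (zero if $A=\emptyset$) and $\mathcal T(f,A)=\mathcal U(f,A)+S_{A^c}(f)$, and let $\Lambda_u=\sup\|\mathcal U(f,A)\|$, $\Lambda_t=\sup\|\mathcal T(f,A)\|$, the suprema being over all $f$ with $\|f\|\le1$ and all finite greedy sets $A$ of $f$. For $\gamma\in\ell_\infty$ let $M_\gamma$ be the continuous linear operator on $\mathbb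 X$ with $M_\gamma(x_n)=\gamma_nx_n$ for all $n$, if it exists; if it exists for every $\gamma\in\ell_\infty$, then $K_u=\sup_{\|\gamma\|_\infty\le1}\|M_\gamma\|$. Finally, for $f\in\mathbb X$ put $$\|f\|_a=\inf\{\|f-S_A(f)+z\| : (A,z)\in\mathcal D(f)\},$$ where $\mathcal D(f)$ is the set of pairs $(A,z)$ with $A\subseteq\operatorname{supp}(f)$ finite, $z\in\mathbb X$, $(\operatorname{supp}(f)\setminus A)\cap\operatorname{supp}(z)=\emptyset$, $|A|\le|\operatorname{supp}(z)|$ and $|x_n^*(f)|\le|x_m^*(z)|$ for all $n\in\mathbb N$ and $m\in\operatorname{supp}(z)$. **Theorem.** 1. If $\mathcal B$ is quasi-greedy, there is a renorming of $\mathbb X$ with respect to which $C_{qg}=\Lambda_t=\Lambda_u=1$. 2. If $\mathcal B$ is almost greedy, then $\|\cdot\|_a$ is a renorming of $\mathbb X$ with respect to which $C_{ag}=\Lambda_t=1$. If, moreover, $C_{qg}=1$ with respect to $\|\cdot\|$, then $C_{qg}=\Lambda_u=1$ with respect to $\|\cdot\|_a$. 3. If $\mathcal B$ is almost greedy, there is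 a renorming of $\mathbb X$ with respect to which $C_{qg}=C_{ag}=\Lambda_u=\Lambda_t=1$. 4. If $\mathcal B$ is greedy, there is a renorming of $\mathbb X$ with respect to which $\mathcal B$ is lattice unconditional (every $M_\gamma$, $\gamma\in\ell_\infty$, exists) and $C_g=K_u=1$. -/

import Mathlib

open Filter Topology

/-- `q` is a quasi-norm on the vector space `X` over `𝕜`. -/
structure IsQuasiNorm (𝕜 : Type*) [RCLike 𝕜] {X : Type*} [AddCommGroup X] [Module 𝕜 X]
    (q : X → ℝ) : Prop where
  nonneg : ∀ f, 0 ≤ q f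
  pos : ∀ f, f ≠ 0 → 0 < q f
  smul : ∀ (t : 𝕜) (f : X), q (t • f) = ‖t‖ * q f
  add_le : ∃ κ : ℝ, 1 ≤ κ ∧ ∀ f g, q (f + g) ≤ κ * (q f + q g)

/-- The balls `{f | q f < ε}`, `ε > 0`, form a base of neighbourhoods of zero. For a quasi-norm `q`
and a topological group `X` this says that the topology of `X` is the one induced by `q`. -/
def InducesTopology {X : Type*} [AddCommGroup X] [TopologicalSpace X] (q : X → ℝ) : Prop :=
  (𝓝 (0 : X)).HasBasis (fun ε : ℝ => 0 < ε) (fun ε => {f | q f < ε})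

/-- `q₀` is a renorming of the (quasi-normable) space `X`: a quasi-norm, not necessarily
continuous, that induces the given topology of `X`. -/
structure IsRenorming (𝕜 : Type*) [RCLike 𝕜] {X : Type*} [AddCommGroup X] [Module 𝕜 X]
    [TopologicalSpace X] (q₀ : X → ℝ) : Prop where
  isQuasiNorm : IsQuasiNorm 𝕜 q₀
  inducesTopology : InducesTopology q₀

/-- A complete Markushevich basis: a sequence with dense linear span, together with its
(unique, continuous) coordinate functionals. -/
structure CompleteMBasis (𝕜 : Type*) [RCLike 𝕜] (X : Type*) [AddCommGroup X] [Module 𝕜 X]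
    [TopologicalSpace X] where
  vec : ℕ → X
  coord : ℕ → X →L[𝕜] 𝕜
  dense_span : Dense (Submodule.span 𝕜 (Set.range vec) : Set X)
  biorthogonal : ∀ n k, coord n (vec k) = if k = n then 1 else 0

/-- The sign of a scalar: `1` at `0`, and `a / |a|` otherwise. -/
noncomputable def scalarSign {𝕜 : Type*} [RCLike 𝕜] (a : 𝕜) : 𝕜 :=
  open Classical in if a = 0 then 1 else a / ((‖a‖ : ℝ) : 𝕜)

namespace CompleteMBasis

variable {𝕜 : Type*} [RCLike 𝕜] {X : Type*} [AddCommGroup X] [Module 𝕜 X] [TopologicalSpace X]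

/-- The support of a vector. -/
def supp (b : CompleteMBasis 𝕜 X) (f : X) : Set ℕ := {n | b.coord n f ≠ 0}

/-- The coordinate projection `S_A` onto a finite set `A`. -/
def proj (b : CompleteMBasis 𝕜 X) (A : Finset ℕ) (f : X) : X :=
  ∑ n ∈ A, b.coord n f • b.vec n

/-- `A` is a greedy set of `f`. -/
def IsGreedySet (b : CompleteMBasis 𝕜 X) (f : X) (A : Set ℕ) : Prop :=
  ∀ n ∈ A, ∀ k ∉ A, ‖b.coord k f‖ ≤ ‖b.coord n f‖

/-- `sup_n ‖x_n‖ ‖x_n^*‖ < ∞`, where `‖x_n^*‖` is the supremum of `|x_n^*(f)|` over `‖f‖ ≤ 1`. -/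
def IsMBounded (b : CompleteMBasis 𝕜 X) (q : X → ℝ) : Prop :=
  ∃ C : ℝ, ∀ n f, q f ≤ 1 → q (b.vec n) * ‖b.coord n f‖ ≤ C

/-- `0 < inf_n ‖x_n‖ ≤ sup_n ‖x_n‖ < ∞`. -/
def IsSemiNormalized (b : CompleteMBasis 𝕜 X) (q : X → ℝ) : Prop :=
  ∃ c C : ℝ, 0 < c ∧ ∀ n, c ≤ q (b.vec n) ∧ q (b.vec n) ≤ C

/-! Greedy-type bases -/

/-- Quasi-greedy basis. -/
def IsQuasiGreedy (b : CompleteMBasis 𝕜 X) (q : X → ℝ) : Prop :=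
  b.IsMBounded q ∧ b.IsSemiNormalized q ∧
    ∃ C : ℝ, ∀ (f : X) (A : Finset ℕ), b.IsGreedySet f A → q (b.proj A f) ≤ C * q f

/-- Almost greedy inequality with constant `C`. -/
def AlmostGreedyWith (b : CompleteMBasis 𝕜 X) (q : X → ℝ) (C : ℝ) : Prop :=
  ∀ (f : X) (A B : Finset ℕ), b.IsGreedySet f A → B.card ≤ A.card →
    q (f - b.proj A f) ≤ C * q (f - b.proj B f)

/-- Almost greedy basis. -/
def IsAlmostGreedy (b : CompleteMBasis 𝕜 X) (q : X → ℝ) : Prop :=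
  b.IsMBounded q ∧ b.IsSemiNormalized q ∧ ∃ C : ℝ, b.AlmostGreedyWith q C

/-- Greedy inequality with constant `C`. -/
def GreedyWith (b : CompleteMBasis 𝕜 X) (q : X → ℝ) (C : ℝ) : Prop :=
  ∀ (f z : X) (A : Finset ℕ), b.IsGreedySet f A → (b.supp z).encard ≤ (A.card : ℕ∞) →
    q (f - b.proj A f) ≤ C * q (f - z)

/-- Greedy basis. -/
def IsGreedy (b : CompleteMBasis 𝕜 X) (q : X → ℝ) : Prop :=
  b.IsMBounded q ∧ b.IsSemiNormalized q ∧ ∃ C : ℝ, b.GreedyWith q C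

/-! The constants of a basis. In each case the predicate says that the constant is `C`, as a
smallest admissible constant (`IsLeast`) or as a supremum (`IsLUB`). -/

/-- `C_qg = C`: the least constant with `‖S_{A \ B}(f)‖ ≤ C ‖f‖` for all `f` and all finite greedy
sets `B ⊆ A` of `f`. -/
def IsQuasiGreedyConst (b : CompleteMBasis 𝕜 X) (q : X → ℝ) (C : ℝ) : Prop :=
  IsLeast {C : ℝ | ∀ (f : X) (A B : Finset ℕ), b.IsGreedySet f A → b.IsGreedySet f B → B ⊆ A →
    q (b.proj (A \ B) f) ≤ C * q f} C

/-- `C_ag = C`. -/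
def IsAlmostGreedyConst (b : CompleteMBasis 𝕜 X) (q : X → ℝ) (C : ℝ) : Prop :=
  IsLeast {C : ℝ | b.AlmostGreedyWith q C} C

/-- `C_g = C`. -/
def IsGreedyConst (b : CompleteMBasis 𝕜 X) (q : X → ℝ) (C : ℝ) : Prop :=
  IsLeast {C : ℝ | b.GreedyWith q C} C

/-- `min_{n ∈ A} |x_n^*(f)|`, and `0` if `A` is empty. -/
noncomputable def minCoord (b : CompleteMBasis 𝕜 X) (f : X) (A : Finset ℕ) : ℝ :=
  open Classical in if h : A.Nonempty then A.inf' h (fun n => ‖b.coord n f‖) else 0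

/-- `𝓤(f, A) = min_{n ∈ A} |x_n^*(f)| ∑_{n ∈ A} sgn(x_n^*(f)) x_n`; it is `0` for `A` empty. -/
noncomputable def restrictedTruncation (b : CompleteMBasis 𝕜 X) (f : X) (A : Finset ℕ) : X :=
  ((b.minCoord f A : ℝ) : 𝕜) • ∑ n ∈ A, scalarSign (b.coord n f) • b.vec n

/-- `𝓣(f, A) = 𝓤(f, A) + S_{A^c}(f)`. -/
noncomputable def truncation (b : CompleteMBasis 𝕜 X) (f : X) (A : Finset ℕ) : X :=
  b.restrictedTruncation f A + (f - b.proj A f)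

/-- `Λ_u = C`, where `Λ_u = sup {‖𝓤(f, A)‖ : A greedy set of f, ‖f‖ ≤ 1}`. Only finite sets `A` are
needed: for infinite greedy sets `𝓤(f, A)` is zero by convention. -/
def IsRestrictedTruncationConst (b : CompleteMBasis 𝕜 X) (q : X → ℝ) (C : ℝ) : Prop :=
  IsLUB {r : ℝ | ∃ (f : X) (A : Finset ℕ), b.IsGreedySet f A ∧ q f ≤ 1 ∧
    r = q (b.restrictedTruncation f A)} C

/-- `Λ_t = C`, where `Λ_t = sup {‖𝓣(f, A)‖ : A greedy set of f, ‖f‖ ≤ 1}`. Only finite sets `A` are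
needed: for infinite greedy sets `𝓣(f, A)` is zero by convention. -/
def IsTruncationConst (b : CompleteMBasis 𝕜 X) (q : X → ℝ) (C : ℝ) : Prop :=
  IsLUB {r : ℝ | ∃ (f : X) (A : Finset ℕ), b.IsGreedySet f A ∧ q f ≤ 1 ∧
    r = q (b.truncation f A)} C

/-- `T` is the (unique) continuous extension to `X` of the multiplier `M_γ`, which is given on the
linear span of the basis by `M_γ(∑ a_n x_n) = ∑ γ_n a_n x_n`. -/
def IsMultiplier (b : CompleteMBasis 𝕜 X) (γ : ℕ → 𝕜) (T : X →L[𝕜] X) : Prop :=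
  ∀ n, T (b.vec n) = γ n • b.vec n

/-- The basis is lattice unconditional with `K_u = C`: for every `γ ∈ ℓ_∞` the operator `M_γ` is
well defined on `X`, and `C` is the supremum of `‖M_γ‖ = sup {‖M_γ(f)‖ : ‖f‖ ≤ 1}` over
`‖γ‖_∞ ≤ 1`. -/
def IsLatticeUnconditionalConst (b : CompleteMBasis 𝕜 X) (q : X → ℝ) (C : ℝ) : Prop :=
  (∀ γ : ℕ → 𝕜, (∃ M : ℝ, ∀ n, ‖γ n‖ ≤ M) → ∃ T : X →L[𝕜] X, b.IsMultiplier γ T) ∧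
  IsLUB {r : ℝ | ∃ (γ : ℕ → 𝕜) (T : X →L[𝕜] X) (f : X), (∀ n, ‖γ n‖ ≤ 1) ∧ b.IsMultiplier γ T ∧
    q f ≤ 1 ∧ r = q (T f)} C

/-! The explicit renorming -/

/-- The set `𝓓(f)` of pairs `(A, z)` with `A ⊆ supp f` finite, `(supp f \ A) ∩ supp z = ∅`,
`|A| ≤ |supp z|` and `|x_n^*(f)| ≤ |x_m^*(z)|` for all `n` and all `m ∈ supp z`. -/
def replacements (b : CompleteMBasis 𝕜 X) (f : X) : Set (Finset ℕ × X) :=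
  {p | (p.1 : Set ℕ) ⊆ b.supp f ∧ (b.supp f \ (p.1 : Set ℕ)) ∩ b.supp p.2 = ∅ ∧
    (p.1.card : ℕ∞) ≤ (b.supp p.2).encard ∧
    ∀ n, ∀ m ∈ b.supp p.2, ‖b.coord n f‖ ≤ ‖b.coord m p.2‖}

/-- `‖f‖_a = inf {‖f - S_A(f) + z‖ : (A, z) ∈ 𝓓(f)}`. -/
noncomputable def almostGreedyNorm (b : CompleteMBasis 𝕜 X) (q : X → ℝ) (f : X) : ℝ :=
  sInf {r : ℝ | ∃ p ∈ b.replacements f, r = q (f - b.proj p.1 f + p.2)}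

end CompleteMBasis

/-! Each renorming is a supremum or an infimum of the given quasi-norm over vectors built from `f`.
Quasi-norms survive any homogeneous two-sided perturbation (`isRenorming_of_equiv`), so convexity
never matters: what has to be shown is equivalence with `q`, and monotonicity under the operations
that should become contractive.

Quasi-greedy case: take the supremum over `IsReduction`. This relation contains both the projections
`S_{A \ B}` and the truncations, and it is transitive, so both become contractive. Equivalence
(`exists_reduction_le`) rests on the truncation estimate `exists_truncation_le` and on
`exists_cube_bound`, which replaces convexity when coefficients vary in a cube.

Almost greedy case: for `almostGreedyNorm`, equivalence holds because the support of `z` is a greedy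
set of `f - S_D(f) + z`, and democracy lets `z` pay for the removed part `S_D(f)`. An inequality
between two such infima follows by turning each replacement of one vector into a replacement of the
other. For the almost greedy and truncation constants the resulting vector is the same. For the
quasi-greedy constant it is a projection of the old one, which is where `C_qg = 1` for `q` enters;
the third claim therefore applies `almostGreedyNorm` to the quasi-norm of the first.

Greedy case: a supremum over coordinatewise dominated vectors gives a lattice quasi-norm, and
`almostGreedyNorm` preserves this domination. Then `C_g = 1` follows from `C_ag = 1`, since with `Z
= supp z` the vector `f - S_Z(f)` is dominated by `f - z`. -/

namespace IsQuasiNorm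

variable {𝕜 : Type*} [RCLike 𝕜] {X : Type*} [AddCommGroup X] [Module 𝕜 X] {q : X → ℝ}

/-! ### Quasi-norms: elementary inequalities and equivalence -/

theorem map_zero (hq : IsQuasiNorm 𝕜 q) : q 0 = 0 := by simpa using hq.smul 0 0

theorem map_neg (hq : IsQuasiNorm 𝕜 q) (f : X) : q (-f) = q f := by
  simpa using hq.smul (-1) f

theorem eq_zero (hq : IsQuasiNorm 𝕜 q) {f : X} (h : q f ≤ 0) : f = 0 := by
  by_contra hf
  exact absurd (hq.pos f hf) (not_lt.2 h)

theorem map_real_smul (hq : IsQuasiNorm 𝕜 q) {t : ℝ} (ht : 0 ≤ t) (f : X) :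
    q ((t : 𝕜) • f) = t * q f := by
  rw [hq.smul, RCLike.norm_ofReal, abs_of_nonneg ht]

theorem sub_le (hq : IsQuasiNorm 𝕜 q) {κ : ℝ} (h : ∀ f g, q (f + g) ≤ κ * (q f + q g))
    (f g : X) : q (f - g) ≤ κ * (q f + q g) := by
  simpa [sub_eq_add_neg, hq.map_neg] using h f (-g)

theorem sum_le (hq : IsQuasiNorm 𝕜 q) {κ : ℝ} (hκ : 1 ≤ κ)
    (h : ∀ f g, q (f + g) ≤ κ * (q f + q g)) {ι : Type*} (s : Finset ι) (v : ι → X) :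
    q (∑ i ∈ s, v i) ≤ κ ^ s.card * ∑ i ∈ s, q (v i) := by
  classical
  induction s using Finset.induction_on with
  | empty => simp [hq.map_zero]
  | insert a s ha ih =>
    rw [Finset.sum_insert ha, Finset.sum_insert ha, Finset.card_insert_of_notMem ha]
    have h1 : 1 ≤ κ ^ s.card := one_le_pow₀ hκ
    calc q (v a + ∑ i ∈ s, v i) ≤ κ * (q (v a) + q (∑ i ∈ s, v i)) := h _ _
      _ ≤ κ * (κ ^ s.card * q (v a) + κ ^ s.card * ∑ i ∈ s, q (v i)) := by
        gcongr
        exact le_mul_of_one_le_left (hq.nonneg _) h1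
      _ = κ ^ (s.card + 1) * (q (v a) + ∑ i ∈ s, q (v i)) := by ring

/-- A bound for the sums over all subfamilies gives a bound for the sums with coefficients in the
unit interval. -/
theorem exists_cube_bound (hq : IsQuasiNorm 𝕜 q) :
    ∃ K : ℝ, 1 ≤ K ∧ ∀ {ι : Type} (s : Finset ι) (v : ι → X) (M : ℝ),
      (∀ B ⊆ s, q (∑ i ∈ B, v i) ≤ M) → ∀ r : ι → ℝ, (∀ i ∈ s, 0 ≤ r i ∧ r i ≤ 1) →
        q (∑ i ∈ s, (r i : 𝕜) • v i) ≤ K * M := by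
  classical
  obtain ⟨κ, hκ, h⟩ := hq.add_le
  -- With `b ≥ 2κ`, a remainder scaled by `1/b` still counts at most one half after the
  -- quasi-triangle inequality.
  obtain ⟨b, hb⟩ := exists_nat_ge (2 * κ)
  have hb0 : (0 : ℝ) < b := by linarith
  refine ⟨2 * κ ^ (b + 1), ?_, ?_⟩
  · have : 1 ≤ κ ^ (b + 1) := one_le_pow₀ hκ
    linarith
  intro ι s v M hM r hr
  have hM0 : 0 ≤ M := (hq.nonneg _).trans (hM ∅ (by simp))
  let S : Set ℝ := {x | ∃ r : ι → ℝ, (∀ i ∈ s, 0 ≤ r i ∧ r i ≤ 1) ∧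
    x = q (∑ i ∈ s, (r i : 𝕜) • v i)}
  -- This crude bound depends on `s` and `v`; it only makes the supremum finite, so that half of it
  -- can be absorbed.
  have hS : BddAbove S := by
    refine ⟨κ ^ s.card * ∑ i ∈ s, q (v i), ?_⟩
    rintro _ ⟨r, hr, rfl⟩
    refine (hq.sum_le hκ h _ _).trans ?_
    gcongr with i hi
    rw [hq.map_real_smul (hr i hi).1]
    exact mul_le_of_le_one_left (hq.nonneg _) (hr i hi).2
  have key : ∀ x ∈ S, x ≤ κ ^ (b + 1) * M + sSup S / 2 := by
    rintro _ ⟨r, hr, rfl⟩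
    let k : ι → ℕ := fun i => ⌊(b : ℝ) * r i⌋₊
    have hk1 : ∀ i ∈ s, (k i : ℝ) ≤ b * r i := fun i hi =>
      Nat.floor_le (mul_nonneg hb0.le (hr i hi).1)
    have hk2 : ∀ i, (b : ℝ) * r i < k i + 1 := fun i => Nat.lt_floor_add_one _
    have hkb : ∀ i ∈ s, k i ≤ b := fun i hi => by
      have := (hk1 i hi).trans (mul_le_of_le_one_right hb0.le (hr i hi).2)
      exact_mod_cast this
    -- Write `b r = k + (b r - k)` with `k` the integer part: the integer part is a sum of `b`
    -- indicator layers, and the fractional part is again a coefficient family in the unit interval.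
    have hsplit : ∑ i ∈ s, (r i : 𝕜) • v i =
        (((b : ℝ)⁻¹ : ℝ) : 𝕜) • ∑ j ∈ Finset.range b, ∑ i ∈ s.filter (fun i => j < k i), v i +
        (((b : ℝ)⁻¹ : ℝ) : 𝕜) • ∑ i ∈ s, ((b * r i - k i : ℝ) : 𝕜) • v i := by
      have : ∑ j ∈ Finset.range b, ∑ i ∈ s.filter (fun i => j < k i), v i =
          ∑ i ∈ s, ((k i : ℝ) : 𝕜) • v i := by
        simp_rw [Finset.sum_filter]
        rw [Finset.sum_comm]
        refine Finset.sum_congr rfl fun i hi => ?_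
        rw [← Finset.sum_filter, Finset.sum_const]
        have : (Finset.range b).filter (fun j => j < k i) = Finset.range (k i) := by
          ext j
          simp only [Finset.mem_filter, Finset.mem_range]
          have := hkb i hi
          omega
        rw [this, Finset.card_range, RCLike.ofReal_natCast, Nat.cast_smul_eq_nsmul]
      rw [this, ← smul_add, ← Finset.sum_add_distrib, Finset.smul_sum]
      refine Finset.sum_congr rfl fun i _ => ?_
      rw [← add_smul, smul_smul, ← RCLike.ofReal_add, ← RCLike.ofReal_mul]
      congr 2
      field_simp
      ring
    have h1 : q ((((b : ℝ)⁻¹ : ℝ) : 𝕜) •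
        ∑ j ∈ Finset.range b, ∑ i ∈ s.filter (fun i => j < k i), v i) ≤ κ ^ b * M := by
      rw [hq.map_real_smul (inv_nonneg.2 hb0.le)]
      have := hq.sum_le hκ h (Finset.range b) (fun j => ∑ i ∈ s.filter (fun i => j < k i), v i)
      have h2 : ∑ j ∈ Finset.range b, q (∑ i ∈ s.filter (fun i => j < k i), v i) ≤ b * M := by
        refine (Finset.sum_le_sum fun j _ => hM _ (Finset.filter_subset _ _)).trans ?_
        simp
      rw [Finset.card_range] at this
      calc _ ≤ (b : ℝ)⁻¹ * (κ ^ b * (b * M)) := by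
            gcongr
            exact this.trans (by gcongr)
        _ = κ ^ b * M := by field_simp
    have h2 : q ((((b : ℝ)⁻¹ : ℝ) : 𝕜) • ∑ i ∈ s, ((b * r i - k i : ℝ) : 𝕜) • v i) ≤
        (b : ℝ)⁻¹ * sSup S := by
      rw [hq.map_real_smul (inv_nonneg.2 hb0.le)]
      gcongr
      refine le_csSup hS ⟨fun i => b * r i - k i, fun i hi => ⟨?_, ?_⟩, rfl⟩
      · linarith [hk1 i hi]
      · linarith [hk2 i]
    have hS0 : 0 ≤ sSup S := Real.sSup_nonneg (by rintro _ ⟨_, _, rfl⟩; exact hq.nonneg _)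
    have h3 : κ * ((b : ℝ)⁻¹ * sSup S) ≤ sSup S / 2 := by
      have : κ * (b : ℝ)⁻¹ ≤ 1 / 2 := by
        rw [← div_eq_mul_inv, div_le_div_iff₀ hb0 two_pos]
        linarith
      nlinarith
    calc q (∑ i ∈ s, (r i : 𝕜) • v i) ≤ κ * (κ ^ b * M + (b : ℝ)⁻¹ * sSup S) := by
          rw [hsplit]
          exact (h _ _).trans (by gcongr)
      _ ≤ κ ^ (b + 1) * M + sSup S / 2 := by
          rw [mul_add, pow_succ]
          linarith
  have hne : S.Nonempty := ⟨_, r, hr, rfl⟩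
  have h4 := csSup_le hne key
  have h5 := key _ ⟨r, hr, rfl⟩
  linarith

end IsQuasiNorm

/-- The quasi-triangle inequality passes through the equivalence at the cost of the constant `K * κ
* L`, so suprema and infima of quasi-norms are both admissible. -/
theorem IsQuasiNorm.isRenorming_of_equiv {𝕜 : Type*} [RCLike 𝕜] {X : Type*} [AddCommGroup X]
    [Module 𝕜 X] [TopologicalSpace X] {q q' : X → ℝ} (hq : IsQuasiNorm 𝕜 q)
    (hqX : InducesTopology q) (hsmul : ∀ (t : 𝕜) f, q' (t • f) = ‖t‖ * q' f) {K L : ℝ}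
    (hK0 : 0 < K) (hL0 : 0 < L) (hK : ∀ f, q' f ≤ K * q f) (hL : ∀ f, q f ≤ L * q' f) :
    IsRenorming 𝕜 q' := by
  obtain ⟨κ, hκ, h⟩ := hq.add_le
  have h0 : ∀ f, 0 ≤ q' f := fun f => nonneg_of_mul_nonneg_right ((hq.nonneg f).trans (hL f)) hL0
  refine ⟨⟨h0, fun f hf => ?_, hsmul, max 1 (K * κ * L), le_max_left _ _, fun f g => ?_⟩, ?_⟩
  · exact pos_of_mul_pos_right ((hq.pos f hf).trans_le (hL f)) hL0.le
  · calc q' (f + g) ≤ K * (κ * (L * q' f + L * q' g)) := by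
          refine (hK _).trans ?_
          gcongr
          exact (h f g).trans (by gcongr <;> exact hL _)
      _ = (K * κ * L) * (q' f + q' g) := by ring
      _ ≤ _ := by
          gcongr
          · exact add_nonneg (h0 f) (h0 g)
          · exact le_max_right _ _
  · refine hqX.to_hasBasis (fun ε hε => ⟨ε / L, by positivity, fun f hf => ?_⟩)
      (fun ε hε => ⟨ε / K, by positivity, fun f hf => ?_⟩)
    · simp only [Set.mem_ofPred_eq, lt_div_iff₀ hL0] at hf ⊢
      exact (hL f).trans_lt (by linarith)
    · simp only [Set.mem_ofPred_eq, lt_div_iff₀ hK0] at hf ⊢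
      exact (hK f).trans_lt (by linarith)

section scalarSign

variable {𝕜 : Type*} [RCLike 𝕜]

theorem norm_scalarSign (a : 𝕜) : ‖scalarSign a‖ = 1 := by
  unfold scalarSign
  split_ifs with h
  · simp
  · simp [h]

theorem norm_smul_scalarSign (a : 𝕜) : ((‖a‖ : ℝ) : 𝕜) * scalarSign a = a := by
  unfold scalarSign
  split_ifs with h
  · simp [h]
  · have : (‖a‖ : 𝕜) ≠ 0 := by simpa using h
    field_simp

end scalarSign

/-! ### Coordinates and approximation by finitely supported vectors -/

namespace CompleteMBasis

variable {𝕜 : Type*} [RCLike 𝕜] {X : Type*} [AddCommGroup X] [Module 𝕜 X] [TopologicalSpace X]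
  (b : CompleteMBasis 𝕜 X)

theorem coord_sum (A : Finset ℕ) (c : ℕ → 𝕜) (k : ℕ) :
    b.coord k (∑ n ∈ A, c n • b.vec n) = if k ∈ A then c k else 0 := by
  simp [map_sum, b.biorthogonal, eq_comm]

theorem coord_proj (A : Finset ℕ) (f : X) (k : ℕ) :
    b.coord k (b.proj A f) = if k ∈ A then b.coord k f else 0 :=
  b.coord_sum A (fun n => b.coord n f) k

theorem coord_sub_proj (A : Finset ℕ) (f : X) (k : ℕ) :
    b.coord k (f - b.proj A f) = if k ∈ A then 0 else b.coord k f := by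
  rw [map_sub, coord_proj]
  split_ifs <;> simp

theorem coord_vec (n k : ℕ) : b.coord n (b.vec k) = if k = n then 1 else 0 :=
  b.biorthogonal n k

@[simp] theorem proj_empty (f : X) : b.proj ∅ f = 0 := by simp [proj]

theorem proj_sub (A : Finset ℕ) (f g : X) : b.proj A (f - g) = b.proj A f - b.proj A g := by
  simp [proj, sub_smul, Finset.sum_sub_distrib]

theorem proj_smul (A : Finset ℕ) (t : 𝕜) (f : X) : b.proj A (t • f) = t • b.proj A f := by
  simp [proj, Finset.smul_sum, smul_smul]

theorem exists_eq_proj_of_mem_span {g : X} (hg : g ∈ Submodule.span 𝕜 (Set.range b.vec)) :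
    ∃ A : Finset ℕ, b.proj A g = g ∧ ∀ n ∉ A, b.coord n g = 0 := by
  obtain ⟨c, rfl⟩ := Finsupp.mem_span_range_iff_exists_finsupp.1 hg
  refine ⟨c.support, ?_, fun n hn => ?_⟩
  · refine Finset.sum_congr rfl fun n hn => ?_
    rw [Finsupp.sum, b.coord_sum, if_pos hn]
  · rw [Finsupp.sum, b.coord_sum, if_neg hn]

/-- Every vector is approximated by vectors of finite support. -/
theorem exists_approx [IsTopologicalAddGroup X] {q : X → ℝ} (hqX : InducesTopology q) (f : X)
    {ε : ℝ} (hε : 0 < ε) :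
    ∃ (g : X) (A : Finset ℕ), q (f - g) < ε ∧ b.proj A g = g ∧ ∀ n ∉ A, b.coord n g = 0 := by
  have h1 : {g | q (f - g) < ε} ∈ 𝓝 f := by
    have h2 : Tendsto (fun g => f - g) (𝓝 f) (𝓝 0) := by
      have : Continuous (fun g : X => f - g) := by fun_prop
      simpa using this.tendsto f
    exact h2 (hqX.mem_of_mem hε)
  obtain ⟨g, hg1, hg2⟩ := b.dense_span.exists_mem_open isOpen_interior
    ⟨f, mem_interior_iff_mem_nhds.2 h1⟩
  obtain ⟨A, hA⟩ := b.exists_eq_proj_of_mem_span hg1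
  have hg3 : g ∈ {g | q (f - g) < ε} := interior_subset hg2
  exact ⟨g, A, hg3, hA⟩

/-- The coordinate functionals are uniformly bounded. -/
def CoordBounded (q : X → ℝ) (a : ℝ) : Prop := ∀ n f, ‖b.coord n f‖ ≤ a * q f

theorem exists_coordBounded {q : X → ℝ} (hq : IsQuasiNorm 𝕜 q) (h1 : b.IsMBounded q)
    (h2 : b.IsSemiNormalized q) : ∃ a, 0 < a ∧ b.CoordBounded q a := by
  obtain ⟨C, hC⟩ := h1
  obtain ⟨c, C', hc, h2⟩ := h2
  refine ⟨max C 1 / c, by positivity, fun n f => ?_⟩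
  rcases eq_or_ne f 0 with rfl | hf
  · simp [hq.map_zero]
  have hf0 := hq.pos f hf
  have h3 := hC n ((((q f)⁻¹ : ℝ) : 𝕜) • f) (by
    rw [hq.map_real_smul (inv_nonneg.2 hf0.le), inv_mul_cancel₀ hf0.ne'])
  rw [map_smul, norm_smul, RCLike.norm_ofReal, abs_of_pos (inv_pos.2 hf0)] at h3
  have h4 : c * ((q f)⁻¹ * ‖b.coord n f‖) ≤ max C 1 :=
    (mul_le_mul_of_nonneg_right (h2 n).1 (by positivity)).trans (h3.trans (le_max_left _ _))
  rw [div_mul_eq_mul_div, le_div_iff₀ hc]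
  calc ‖b.coord n f‖ * c = c * ((q f)⁻¹ * ‖b.coord n f‖) * q f := by field_simp
    _ ≤ _ := by gcongr

/-- The coordinates of `f` tend to zero: off the support of a finitely supported approximant `g`
they are coordinates of the small vector `f - g`. -/
theorem finite_le_norm_coord [IsTopologicalAddGroup X] {q : X → ℝ} (hqX : InducesTopology q)
    {a : ℝ} (ha : 0 < a) (h : b.CoordBounded q a) (f : X) {ε : ℝ} (hε : 0 < ε) :
    {n | ε ≤ ‖b.coord n f‖}.Finite := by
  obtain ⟨g, A, h1, -, h3⟩ := b.exists_approx hqX f (div_pos hε ha)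
  refine A.finite_toSet.subset fun n hn => ?_
  by_contra hA
  have h4 := h n (f - g)
  rw [map_sub, h3 n hA, sub_zero] at h4
  rw [lt_div_iff₀ ha] at h1
  exact absurd (hn.trans h4) (by rw [not_le]; linarith)

/-- Used to dispose of infinite greedy sets and of vectors `z` with infinite support. -/
theorem eq_zero_of_infinite_le [IsTopologicalAddGroup X] {q : X → ℝ} (hqX : InducesTopology q)
    {a : ℝ} (ha : 0 < a) (h : b.CoordBounded q a) {f : X} {A : Set ℕ} (hA : A.Infinite) {t : ℝ}
    (ht : ∀ n ∈ A, t ≤ ‖b.coord n f‖) : t ≤ 0 := by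
  by_contra! h0
  exact hA ((b.finite_le_norm_coord hqX ha h f h0).subset ht)

end CompleteMBasis

/-! ### Quasi-greedy bases: totality and the truncation estimate -/

namespace CompleteMBasis

variable {𝕜 : Type*} [RCLike 𝕜] {X : Type*} [AddCommGroup X] [Module 𝕜 X] [TopologicalSpace X]
  (b : CompleteMBasis 𝕜 X)

/-- The coordinate functionals separate the points. -/
def IsTotal : Prop := ∀ f, (∀ n, b.coord n f = 0) → f = 0

variable {b}

theorem IsTotal.ext (h : b.IsTotal) {f g : X} (hfg : ∀ n, b.coord n f = b.coord n g) : f = g :=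
  sub_eq_zero.1 (h _ fun n => by rw [map_sub, hfg, sub_self])

variable (b)

/-- The quasi-greedy inequality with constant `C`. -/
def QuasiGreedyWith (q : X → ℝ) (C : ℝ) : Prop :=
  ∀ (f : X) (A : Finset ℕ), b.IsGreedySet f A → q (b.proj A f) ≤ C * q f

variable {b} {q : X → ℝ}

/-- If all coordinates of `f` vanish and `g` approximates `f` with support in `A`, then `A` is
greedy for `f - g` and the projection of `f - g` is `-g`. Hence `g`, and with it `f`, is small. -/
theorem QuasiGreedyWith.isTotal [IsTopologicalAddGroup X] (hq : IsQuasiNorm 𝕜 q)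
    (hqX : InducesTopology q) {C : ℝ} (hC0 : 0 ≤ C) (hC : b.QuasiGreedyWith q C) :
    b.IsTotal := by
  intro f hf
  obtain ⟨κ, hκ, h⟩ := hq.add_le
  refine hq.eq_zero (le_of_forall_pos_le_add fun ε hε => ?_)
  obtain ⟨g, A, h1, h2, h3⟩ := b.exists_approx hqX f (ε := ε / (κ * (1 + C))) (by positivity)
  have h4 : b.IsGreedySet (f - g) A := fun n _ k hk => by
    rw [map_sub, hf, h3 k hk]
    simp
  have h5 := hC _ _ h4
  have h6 : b.proj A f = 0 := by simp [proj, hf]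
  rw [proj_sub, h6, h2, zero_sub, hq.map_neg] at h5
  rw [lt_div_iff₀ (by positivity)] at h1
  calc q f = q (f - g + g) := by simp
    _ ≤ κ * (q (f - g) + C * q (f - g)) := (h _ _).trans (by gcongr)
    _ = q (f - g) * (κ * (1 + C)) := by ring
    _ ≤ 0 + ε := by linarith

/-- For coefficients of equal modulus every subset of the support is a greedy set. -/
theorem QuasiGreedyWith.sum_subset {C : ℝ} (hC : b.QuasiGreedyWith q C) {A B : Finset ℕ}
    (hBA : B ⊆ A) {ε : ℕ → 𝕜} (hε : ∀ n, ‖ε n‖ = 1) :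
    q (∑ n ∈ B, ε n • b.vec n) ≤ C * q (∑ n ∈ A, ε n • b.vec n) := by
  have h1 : b.IsGreedySet (∑ n ∈ A, ε n • b.vec n) B := by
    intro n hn k _
    rw [coord_sum, coord_sum, if_pos (hBA hn), hε]
    split_ifs <;> simp [hε]
  convert hC _ _ h1 using 2
  refine Finset.sum_congr rfl fun n hn => ?_
  rw [coord_sum, if_pos (hBA hn)]

/-- Bounded families of coefficients, compared with signs. -/
theorem QuasiGreedyWith.exists_sum_le (hq : IsQuasiNorm 𝕜 q) {C : ℝ} (hC0 : 1 ≤ C)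
    (hC : b.QuasiGreedyWith q C) :
    ∃ K : ℝ, 1 ≤ K ∧ ∀ (A : Finset ℕ) (ε : ℕ → 𝕜), (∀ n, ‖ε n‖ = 1) → ∀ (t : ℝ) (r : ℕ → ℝ),
      0 ≤ t → (∀ n ∈ A, 0 ≤ r n ∧ r n ≤ t) →
        q (∑ n ∈ A, ((r n : 𝕜) * ε n) • b.vec n) ≤ K * (t * q (∑ n ∈ A, ε n • b.vec n)) := by
  obtain ⟨K, hK, h⟩ := hq.exists_cube_bound
  refine ⟨K * C, one_le_mul_of_one_le_of_one_le hK hC0, fun A ε hε t r ht hr => ?_⟩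
  rcases ht.eq_or_lt with rfl | ht
  · have : ∑ n ∈ A, ((r n : 𝕜) * ε n) • b.vec n = 0 := Finset.sum_eq_zero fun n hn => by
      have : r n = 0 := le_antisymm (hr n hn).2 (hr n hn).1
      simp [this]
    simp [this, hq.map_zero]
  have h1 := h A (fun n => ε n • b.vec n) _ (fun B hB => hC.sum_subset hB hε) (fun n => r n / t)
    (fun n hn => ⟨div_nonneg (hr n hn).1 ht.le, (div_le_one ht).2 (hr n hn).2⟩)
  have h2 : ∑ n ∈ A, ((r n : 𝕜) * ε n) • b.vec n =
      (t : 𝕜) • ∑ n ∈ A, ((r n / t : ℝ) : 𝕜) • ε n • b.vec n := by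
    rw [Finset.smul_sum]
    refine Finset.sum_congr rfl fun n _ => ?_
    rw [smul_smul, smul_smul, ← RCLike.ofReal_mul, mul_div_cancel₀ _ ht.ne', ← smul_smul]
  rw [h2, hq.map_real_smul ht.le]
  calc _ ≤ t * (K * (C * q (∑ n ∈ A, ε n • b.vec n))) := by gcongr
    _ = _ := by ring

theorem isGreedySet_filter {f : X} {A : Finset ℕ} (hA : b.IsGreedySet f A) (u : ℝ) :
    b.IsGreedySet f ((A.filter fun n => u ≤ ‖b.coord n f‖ : Finset ℕ) : Set ℕ) := by
  intro n hn k hk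
  simp only [Finset.coe_filter, Set.mem_ofPred_eq, not_and, not_le] at hn hk
  by_cases hkA : k ∈ A
  · exact (hk hkA).le.trans hn.2
  · exact hA n hn.1 k hkA

theorem proj_sdiff {A B : Finset ℕ} (h : B ⊆ A) (f : X) :
    b.proj (A \ B) f = b.proj A f - b.proj B f :=
  eq_sub_of_add_eq (Finset.sum_sdiff h)

theorem QuasiGreedyWith.proj_sdiff_le (hq : IsQuasiNorm 𝕜 q) {κ : ℝ} (hκ : 0 ≤ κ)
    (h : ∀ f g, q (f + g) ≤ κ * (q f + q g)) {C : ℝ} (hC : b.QuasiGreedyWith q C)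
    {f : X} {A B : Finset ℕ} (hA : b.IsGreedySet f A) (hB : b.IsGreedySet f B) (hBA : B ⊆ A) :
    q (b.proj (A \ B) f) ≤ 2 * κ * C * q f := by
  rw [proj_sdiff hBA]
  calc _ ≤ κ * (C * q f + C * q f) := by
        refine (hq.sub_le h _ _).trans ?_
        gcongr
        · exact hC f A hA
        · exact hC f B hB
    _ = _ := by ring

/-- On a thin band the projection of `f` is `u` times the sign sum, up to coefficients of size at
most `δ * u`. The projection is controlled as a difference of two greedy projections, and the error
is absorbed. -/
theorem QuasiGreedyWith.exists_level_le (hq : IsQuasiNorm 𝕜 q) {C : ℝ} (hC0 : 1 ≤ C)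
    (hC : b.QuasiGreedyWith q C) :
    ∃ δ P : ℝ, 0 < δ ∧ 0 ≤ P ∧ ∀ (f : X) (A : Finset ℕ), b.IsGreedySet f A →
      ∀ (u v : ℝ), 0 < u → v ≤ u + δ * u →
        ∀ E : Finset ℕ, (∀ n, n ∈ E ↔ n ∈ A ∧ u ≤ ‖b.coord n f‖ ∧ ‖b.coord n f‖ < v) →
          u * q (∑ n ∈ E, scalarSign (b.coord n f) • b.vec n) ≤ P * q f := by
  obtain ⟨κ, hκ, h⟩ := hq.add_le
  obtain ⟨K, hK, hKs⟩ := hC.exists_sum_le hq hC0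
  -- This `δ` makes the error term `κ * K * δ` equal to one half.
  refine ⟨1 / (2 * κ * K), 4 * κ * κ * C, by positivity, by positivity, ?_⟩
  intro f A hA u v hu huv E hE
  set δ := 1 / (2 * κ * K) with hδ
  set s := ∑ n ∈ E, scalarSign (b.coord n f) • b.vec n with hs
  have hδ0 : 0 < δ := by positivity
  have h1 : q (b.proj E f) ≤ 2 * κ * C * q f := by
    rcases lt_or_ge v u with hvu | hvu
    · have : E = ∅ := Finset.eq_empty_of_forall_notMem fun n hn => by
        have := (hE n).1 hn
        linarith [this.2.1, this.2.2]
      have h0 := hq.nonneg f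
      rw [this, proj_empty, hq.map_zero]
      positivity
    have h2 : E = (A.filter fun n => u ≤ ‖b.coord n f‖) \ (A.filter fun n => v ≤ ‖b.coord n f‖) := by
      ext n
      simp only [hE, Finset.mem_sdiff, Finset.mem_filter]
      grind
    rw [h2]
    refine hC.proj_sdiff_le hq (by positivity) h (isGreedySet_filter hA u)
      (isGreedySet_filter hA v) fun n hn => ?_
    rw [Finset.mem_filter] at hn ⊢
    exact ⟨hn.1, hvu.trans hn.2⟩
  have h2 := hKs E (fun n => scalarSign (b.coord n f)) (fun n => norm_scalarSign _) (δ * u)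
    (fun n => ‖b.coord n f‖ - u) (by positivity) (fun n hn => by
      have := (hE n).1 hn
      constructor <;> linarith [this.2.1, this.2.2])
  have h3 : (u : 𝕜) • s = b.proj E f -
      ∑ n ∈ E, (((‖b.coord n f‖ - u : ℝ) : 𝕜) * scalarSign (b.coord n f)) • b.vec n := by
    rw [hs, proj, ← Finset.sum_sub_distrib, Finset.smul_sum]
    refine Finset.sum_congr rfl fun n _ => ?_
    rw [smul_smul, ← sub_smul]
    congr 1
    rw [RCLike.ofReal_sub, sub_mul, norm_smul_scalarSign]
    ring
  have h4 : u * q s ≤ κ * (2 * κ * C * q f + K * (δ * u * q s)) := by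
    rw [← hq.map_real_smul (𝕜 := 𝕜) hu.le, h3]
    exact (hq.sub_le h _ _).trans (by gcongr)
  have h5 : κ * (K * (δ * u * q s)) = u * q s / 2 := by
    rw [hδ]
    field_simp
  linarith

/-- Quasi-greedy bases are truncation quasi-greedy. -/
theorem QuasiGreedyWith.exists_truncation_le (hq : IsQuasiNorm 𝕜 q) {C : ℝ} (hC0 : 1 ≤ C)
    (hC : b.QuasiGreedyWith q C) :
    ∃ W : ℝ, 0 ≤ W ∧ ∀ (f : X) (A : Finset ℕ), b.IsGreedySet f A → ∀ t : ℝ,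
      0 ≤ t → (∀ n ∈ A, t ≤ ‖b.coord n f‖) →
        t * q (∑ n ∈ A, scalarSign (b.coord n f) • b.vec n) ≤ W * q f := by
  obtain ⟨κ, hκ, h⟩ := hq.add_le
  obtain ⟨δ, P, hδ, hP, hlev⟩ := hC.exists_level_le hq hC0
  -- `J` bands of width `δ * u` cover the heights from `u` to `2 * κ * u`, whatever `u` is.
  obtain ⟨J, hJ⟩ := exists_nat_ge (2 * κ / δ)
  rw [div_le_iff₀ hδ] at hJ
  set W := 2 * κ * (κ ^ J * (J * P)) with hW
  have hW0 : 0 ≤ W := by positivity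
  refine ⟨W, hW0, fun f A => ?_⟩
  have hf0 := hq.nonneg f
  induction A using Finset.strongInduction with
  | H A ih =>
  intro hA t ht htA
  rcases A.eq_empty_or_nonempty with rfl | hne
  · simp only [Finset.sum_empty, hq.map_zero, mul_zero]
    positivity
  obtain ⟨m, hm, hmin⟩ := A.exists_min_image (fun n => ‖b.coord n f‖) hne
  set u := ‖b.coord m f‖ with hu
  rcases (norm_nonneg (b.coord m f)).eq_or_lt with hu0 | hu0
  · have : t = 0 := le_antisymm ((htA m hm).trans hu0.ge) ht
    simp only [this, zero_mul]
    positivity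
  rw [← hu] at hu0
  refine (mul_le_mul_of_nonneg_right (htA m hm) (hq.nonneg _)).trans ?_
  rw [← hu]
  set ε : ℕ → 𝕜 := fun n => scalarSign (b.coord n f) with hε
  have hsum : ∑ n ∈ A, ε n • b.vec n =
      ∑ n ∈ A.filter (fun n => ¬ 2 * κ * u ≤ ‖b.coord n f‖), ε n • b.vec n +
      ∑ n ∈ A.filter (fun n => 2 * κ * u ≤ ‖b.coord n f‖), ε n • b.vec n := by
    rw [add_comm, Finset.sum_filter_add_sum_filter_not]
  -- The part above `2 * κ * u` is a smaller greedy set. The gain `2 * κ` in height beats the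
  -- quasi-triangle constant, so it contributes only `W / 2`, with the same `W` at every stage of
  -- the induction; the bands contribute the other half.
  have h2 := ih (A.filter (fun n => 2 * κ * u ≤ ‖b.coord n f‖))
    (Finset.filter_ssubset.2 ⟨m, hm, by rw [not_le, ← hu]; nlinarith⟩) (isGreedySet_filter hA _)
    (2 * κ * u) (by positivity) (fun n hn => (Finset.mem_filter.1 hn).2)
  have h1 : u * q (∑ n ∈ A.filter (fun n => ¬ 2 * κ * u ≤ ‖b.coord n f‖), ε n • b.vec n) ≤
      κ ^ J * (J * P) * q f := by
    set A₁ := A.filter (fun n => ¬ 2 * κ * u ≤ ‖b.coord n f‖) with hA₁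
    let l : ℕ → ℕ := fun n => ⌊(‖b.coord n f‖ / u - 1) / δ⌋₊
    have hl0 : ∀ n ∈ A, 0 ≤ (‖b.coord n f‖ / u - 1) / δ := fun n hn => by
      have : 1 ≤ ‖b.coord n f‖ / u := (one_le_div hu0).2 (hmin n hn)
      exact div_nonneg (by linarith) hδ.le
    have hlJ : ∀ n ∈ A₁, l n ∈ Finset.range J := fun n hn => by
      rw [hA₁, Finset.mem_filter, not_le] at hn
      rw [Finset.mem_range, Nat.floor_lt (hl0 n hn.1), div_lt_iff₀ hδ]
      have := (div_lt_iff₀ hu0).2 hn.2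
      linarith
    rw [← Finset.sum_fiberwise_of_maps_to hlJ]
    have h3 : ∀ j ∈ Finset.range J,
        u * q (∑ n ∈ A₁.filter (fun n => l n = j), ε n • b.vec n) ≤ P * q f := by
      intro j _
      -- Band `j` starts at `u * (1 + j * δ)`, so its width `δ * u` is at most `δ` times its start.
      -- It is cut at `2 * κ * u`, where `A₁` ends.
      have hj : u ≤ u * (1 + j * δ) := le_mul_of_one_le_right hu0.le (by simp; positivity)
      refine (mul_le_mul_of_nonneg_right hj (hq.nonneg _)).trans (hlev f A hA (u * (1 + j * δ))
        (min (u * (1 + (j + 1) * δ)) (2 * κ * u)) (by positivity) ?_ _ fun n => ?_)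
      · refine (min_le_left _ _).trans ?_
        nlinarith [mul_le_mul_of_nonneg_left hj hδ.le]
      · rw [Finset.mem_filter, hA₁, Finset.mem_filter, and_assoc, not_le, lt_min_iff]
        refine and_congr_right fun hn => ?_
        rw [Nat.floor_eq_iff (hl0 n hn), le_div_iff₀ hδ, div_lt_iff₀ hδ, le_sub_iff_add_le,
          sub_lt_iff_lt_add, le_div_iff₀ hu0, div_lt_iff₀ hu0, add_comm (_ * δ) 1, mul_comm u,
          add_comm (_ * δ) 1, mul_comm u]
        tauto
    calc _ ≤ u * (κ ^ J * ∑ j ∈ Finset.range J,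
            q (∑ n ∈ A₁.filter (fun n => l n = j), ε n • b.vec n)) := by
          gcongr
          simpa using hq.sum_le hκ h (Finset.range J)
            (fun j => ∑ n ∈ A₁.filter (fun n => l n = j), ε n • b.vec n)
      _ = κ ^ J * ∑ j ∈ Finset.range J,
            u * q (∑ n ∈ A₁.filter (fun n => l n = j), ε n • b.vec n) := by
          rw [Finset.mul_sum, Finset.mul_sum, Finset.mul_sum]
          exact Finset.sum_congr rfl fun _ _ => by ring
      _ ≤ κ ^ J * ∑ j ∈ Finset.range J, P * q f := by
          exact mul_le_mul_of_nonneg_left (Finset.sum_le_sum h3) (by positivity)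
      _ = _ := by
          simp
          ring
  have h4 := h (∑ n ∈ A.filter (fun n => ¬ 2 * κ * u ≤ ‖b.coord n f‖), ε n • b.vec n)
    (∑ n ∈ A.filter (fun n => 2 * κ * u ≤ ‖b.coord n f‖), ε n • b.vec n)
  rw [← hsum] at h4
  have h5 := mul_le_mul_of_nonneg_left h4 hu0.le
  have h6 := mul_le_mul_of_nonneg_left h1 (by positivity : 0 ≤ κ)
  calc _ ≤ _ := h5
    _ ≤ κ * (κ ^ J * (J * P) * q f) + W * q f / 2 := by linarith
    _ = W * q f := by rw [hW]; ring

end CompleteMBasis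

namespace IsQuasiNorm

variable {𝕜 : Type*} [RCLike 𝕜] {X : Type*} [AddCommGroup X] [Module 𝕜 X] [TopologicalSpace X]
  {q : X → ℝ} (b : CompleteMBasis 𝕜 X)

theorem _root_.CompleteMBasis.vec_ne_zero (n : ℕ) : b.vec n ≠ 0 := fun h => by
  have := b.coord_vec n n
  simp [h] at this

/-- A test vector showing that the optimal constants cannot be smaller than one. -/
theorem exists_normalized (hq : IsQuasiNorm 𝕜 q) :
    ∃ f : X, q f = 1 ∧ (∀ n ≠ 0, b.coord n f = 0) ∧ b.proj {0} f = f := by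
  have h0 := hq.pos _ (b.vec_ne_zero 0)
  refine ⟨(((q (b.vec 0))⁻¹ : ℝ) : 𝕜) • b.vec 0, ?_, fun n hn => ?_, ?_⟩
  · rw [hq.map_real_smul (inv_nonneg.2 h0.le), inv_mul_cancel₀ h0.ne']
  · rw [map_smul, b.coord_vec, if_neg hn.symm, smul_zero]
  · simp [CompleteMBasis.proj, b.coord_vec]

end IsQuasiNorm

/-- The reverse inequality is the hypothesis applied to the inverse scalar. -/
theorem map_smul_eq_of_map_smul_le {𝕜 : Type*} [RCLike 𝕜] {X : Type*} [AddCommGroup X] [Module 𝕜 X]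
    {q : X → ℝ} (h0 : ∀ f, 0 ≤ q f) (h : ∀ (t : 𝕜) f, q (t • f) ≤ ‖t‖ * q f) (t : 𝕜) (f : X) :
    q (t • f) = ‖t‖ * q f := by
  refine (h t f).antisymm ?_
  rcases eq_or_ne t 0 with rfl | ht
  · simpa using h0 0
  · have := h t⁻¹ (t • f)
    rw [smul_smul, inv_mul_cancel₀ ht, one_smul, norm_inv] at this
    rwa [← le_inv_mul_iff₀ (norm_pos_iff.2 ht)]

namespace CompleteMBasis

variable {𝕜 : Type*} [RCLike 𝕜] {X : Type*} [AddCommGroup X] [Module 𝕜 X] [TopologicalSpace X]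
  {b : CompleteMBasis 𝕜 X} {q : X → ℝ}

/-! ### Truncations -/

theorem minCoord_nonneg (f : X) (A : Finset ℕ) : 0 ≤ b.minCoord f A := by
  unfold minCoord
  split_ifs with h
  · exact (Finset.le_inf'_iff h _).2 fun _ _ => norm_nonneg _
  · rfl

theorem minCoord_le (f : X) {A : Finset ℕ} {n : ℕ} (hn : n ∈ A) :
    b.minCoord f A ≤ ‖b.coord n f‖ := by
  rw [minCoord, dif_pos ⟨n, hn⟩]
  exact Finset.inf'_le _ hn

theorem le_minCoord {f : X} {A : Finset ℕ} (h : A.Nonempty) {t : ℝ}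
    (ht : ∀ n ∈ A, t ≤ ‖b.coord n f‖) : t ≤ b.minCoord f A := by
  rw [minCoord, dif_pos h]
  exact (Finset.le_inf'_iff h _).2 ht

theorem coord_restrictedTruncation (f : X) (A : Finset ℕ) (k : ℕ) :
    b.coord k (b.restrictedTruncation f A) =
      if k ∈ A then (b.minCoord f A : 𝕜) * scalarSign (b.coord k f) else 0 := by
  rw [restrictedTruncation, map_smul, coord_sum]
  split_ifs <;> simp

theorem coord_truncation (f : X) (A : Finset ℕ) (k : ℕ) :
    b.coord k (b.truncation f A) =
      if k ∈ A then (b.minCoord f A : 𝕜) * scalarSign (b.coord k f) else b.coord k f := by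
  rw [truncation, map_add, coord_restrictedTruncation, coord_sub_proj]
  split_ifs <;> simp

theorem norm_minCoord_mul_sign (f : X) (A : Finset ℕ) (a : 𝕜) :
    ‖(b.minCoord f A : 𝕜) * scalarSign a‖ = b.minCoord f A := by
  rw [norm_mul, norm_scalarSign, mul_one, RCLike.norm_ofReal, abs_of_nonneg (minCoord_nonneg f A)]

theorem minCoord_mul_sign {f : X} {A : Finset ℕ} {n : ℕ} (hn : n ∈ A) :
    ∃ c : ℝ, 0 ≤ c ∧
      (b.minCoord f A : 𝕜) * scalarSign (b.coord n f) = (c : 𝕜) * b.coord n f := by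
  refine ⟨b.minCoord f A / ‖b.coord n f‖, div_nonneg (minCoord_nonneg f A) (norm_nonneg _), ?_⟩
  conv_rhs => rw [← norm_smul_scalarSign (b.coord n f)]
  rw [← mul_assoc, ← RCLike.ofReal_mul]
  rcases eq_or_ne (b.coord n f) 0 with h0 | h0
  · have : b.minCoord f A = 0 :=
      le_antisymm (by simpa [h0] using minCoord_le (b := b) f hn) (minCoord_nonneg f A)
    simp [this]
  · simp only [norm_mul, RCLike.norm_ofReal, norm_scalarSign, mul_one, abs_norm]
    rw [div_mul_cancel₀ _ (norm_ne_zero_iff.2 h0)]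

/-! ### Optimal constants -/

theorem isQuasiGreedyConst_one (hq : IsQuasiNorm 𝕜 q)
    (h : ∀ (f : X) (A B : Finset ℕ), b.IsGreedySet f A → b.IsGreedySet f B → B ⊆ A →
      q (b.proj (A \ B) f) ≤ q f) : b.IsQuasiGreedyConst q 1 := by
  refine ⟨fun f A B hA hB hBA => by simpa using h f A B hA hB hBA, fun C hC => ?_⟩
  obtain ⟨f, h1, h2, h3⟩ := hq.exists_normalized b
  have := hC f {0} ∅ (fun n _ k hk => by simp [h2 k (by simpa using hk)])
    (fun n hn => by simp at hn) (by simp)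
  simpa [h3, h1] using this

theorem isAlmostGreedyConst_one (hq : IsQuasiNorm 𝕜 q) (h : b.AlmostGreedyWith q 1) :
    b.IsAlmostGreedyConst q 1 := by
  refine ⟨h, fun C hC => ?_⟩
  obtain ⟨f, h1, -⟩ := hq.exists_normalized b
  simpa [h1] using hC f ∅ ∅ (fun n hn => by simp at hn) le_rfl

theorem isGreedyConst_one (hq : IsQuasiNorm 𝕜 q) (h : b.GreedyWith q 1) :
    b.IsGreedyConst q 1 := by
  refine ⟨h, fun C hC => ?_⟩
  obtain ⟨f, h1, -⟩ := hq.exists_normalized b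
  simpa [h1] using hC f 0 ∅ (fun n hn => by simp at hn) (by simp [supp])

theorem isTruncationConst_one (hq : IsQuasiNorm 𝕜 q)
    (h : ∀ (f : X) (A : Finset ℕ), b.IsGreedySet f A → q (b.truncation f A) ≤ q f) :
    b.IsTruncationConst q 1 := by
  refine ⟨?_, fun C hC => ?_⟩
  · rintro _ ⟨f, A, hA, hf, rfl⟩
    exact (h f A hA).trans hf
  · obtain ⟨f, h1, -⟩ := hq.exists_normalized b
    exact hC ⟨f, ∅, fun n hn => by simp at hn, h1.le, by
      simp [truncation, restrictedTruncation, h1]⟩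

theorem isRestrictedTruncationConst_one (hq : IsQuasiNorm 𝕜 q)
    (h : ∀ (f : X) (A : Finset ℕ), b.IsGreedySet f A → q (b.restrictedTruncation f A) ≤ q f) :
    b.IsRestrictedTruncationConst q 1 := by
  refine ⟨?_, fun C hC => ?_⟩
  · rintro _ ⟨f, A, hA, hf, rfl⟩
    exact (h f A hA).trans hf
  · obtain ⟨f, h1, h2, h3⟩ := hq.exists_normalized b
    refine hC ⟨f, {0}, fun n _ k hk => by simp [h2 k (by simpa using hk)], h1.le, ?_⟩
    have : b.restrictedTruncation f {0} = b.proj {0} f := by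
      simp [restrictedTruncation, minCoord, proj, smul_smul, norm_smul_scalarSign]
    rw [this, h3, h1]

/-- If `C_qg = Λ_t = 1` then `Λ_u ≤ 1`. -/
theorem restrictedTruncation_le
    (h1 : ∀ (f : X) (A B : Finset ℕ), b.IsGreedySet f A → b.IsGreedySet f B → B ⊆ A →
      q (b.proj (A \ B) f) ≤ q f)
    (h2 : ∀ (f : X) (A : Finset ℕ), b.IsGreedySet f A → q (b.truncation f A) ≤ q f)
    (f : X) (A : Finset ℕ) (hA : b.IsGreedySet f A) : q (b.restrictedTruncation f A) ≤ q f := by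
  refine le_trans ?_ (h2 f A hA)
  -- `A` stays greedy for the truncated vector, whose projection onto `A` is the restricted
  -- truncation.
  have h3 : b.IsGreedySet (b.truncation f A) A := fun n hn k hk => by
    rw [Finset.mem_coe] at hn hk
    rw [coord_truncation, coord_truncation, if_pos hn, if_neg hk, norm_minCoord_mul_sign]
    exact le_minCoord ⟨n, hn⟩ fun m hm => hA m hm k hk
  have h4 := h1 _ A ∅ h3 (fun n hn => by simp at hn) (by simp)
  have h5 : b.restrictedTruncation f A = b.proj (A \ ∅) (b.truncation f A) := ?_
  · rwa [h5]
  rw [Finset.sdiff_empty, proj, restrictedTruncation, Finset.smul_sum]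
  refine Finset.sum_congr rfl fun n hn => ?_
  rw [coord_truncation, if_pos hn, smul_smul]

/-! ### The renorming of a quasi-greedy basis -/

/-- `g` is obtained from `f` by removing the coordinates outside of a greedy set `A`, and levelling
down the coordinates in a smaller greedy set `B`. -/
def IsReduction (b : CompleteMBasis 𝕜 X) (f g : X) : Prop :=
  ∃ A B : Set ℕ, B ⊆ A ∧ b.IsGreedySet f A ∧ b.IsGreedySet f B ∧
    (∀ n ∈ B, ∃ c : ℝ, 0 ≤ c ∧ b.coord n g = (c : 𝕜) * b.coord n f) ∧
    (∀ n ∈ B, ∀ m ∈ B, ‖b.coord n g‖ ≤ ‖b.coord m f‖) ∧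
    (∀ n ∈ A, n ∉ B → b.coord n g = b.coord n f) ∧ ∀ n ∉ A, b.coord n g = 0

theorem isGreedySet_univ (f : X) : b.IsGreedySet f Set.univ := fun _ _ _ hk => absurd trivial hk

theorem isGreedySet_empty (f : X) : b.IsGreedySet f ∅ := fun _ hn => absurd hn (by simp)

/-- The identity and the truncations need `A` to be everything, which is why `IsReduction` allows
infinite sets. -/
theorem IsReduction.refl (f : X) : b.IsReduction f f :=
  ⟨Set.univ, ∅, by simp, isGreedySet_univ f, isGreedySet_empty f, by simp, by simp, by simp,
    fun n hn => absurd trivial hn⟩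

theorem IsReduction.of_coord_eq_zero (f : X) {g : X} (hg : ∀ n, b.coord n g = 0) :
    b.IsReduction f g :=
  ⟨∅, ∅, le_rfl, isGreedySet_empty f, isGreedySet_empty f, by simp, by simp, by simp,
    fun n _ => hg n⟩

theorem IsReduction.norm_le {f g : X} (h : b.IsReduction f g) (n : ℕ) :
    ‖b.coord n g‖ ≤ ‖b.coord n f‖ := by
  obtain ⟨A, B, hBA, hA, hB, h1, h2, h3, h4⟩ := h
  by_cases hnB : n ∈ B
  · exact h2 n hnB n hnB
  by_cases hnA : n ∈ A
  · exact (congrArg _ (h3 n hnA hnB)).le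
  · simp [h4 n hnA]

theorem IsReduction.exists_mul {f g : X} (h : b.IsReduction f g) (n : ℕ) :
    ∃ c : ℝ, 0 ≤ c ∧ b.coord n g = (c : 𝕜) * b.coord n f := by
  obtain ⟨A, B, hBA, hA, hB, h1, h2, h3, h4⟩ := h
  by_cases hnB : n ∈ B
  · exact h1 n hnB
  by_cases hnA : n ∈ A
  · exact ⟨1, zero_le_one, by simp [h3 n hnA hnB]⟩
  · exact ⟨0, le_rfl, by simp [h4 n hnA]⟩

theorem IsReduction.smul {f g : X} (h : b.IsReduction f g) (t : 𝕜) :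
    b.IsReduction (t • f) (t • g) := by
  obtain ⟨A, B, hBA, hA, hB, h1, h2, h3, h4⟩ := h
  refine ⟨A, B, hBA, fun n hn k hk => ?_, fun n hn k hk => ?_, fun n hn => ?_,
    fun n hn m hm => ?_, fun n hn hnB => ?_, fun n hn => ?_⟩
  · simpa [norm_smul] using mul_le_mul_of_nonneg_left (hA n hn k hk) (norm_nonneg t)
  · simpa [norm_smul] using mul_le_mul_of_nonneg_left (hB n hn k hk) (norm_nonneg t)
  · obtain ⟨c, hc, h⟩ := h1 n hn
    exact ⟨c, hc, by rw [map_smul, map_smul, h, smul_eq_mul, smul_eq_mul]; ring⟩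
  · simpa [norm_smul] using mul_le_mul_of_nonneg_left (h2 n hn m hm) (norm_nonneg t)
  · rw [map_smul, map_smul, h3 n hn hnB]
  · rw [map_smul, h4 n hn, smul_zero]

theorem IsReduction.trans {f g h : X} (hfg : b.IsReduction f g) (hgh : b.IsReduction g h) :
    b.IsReduction f h := by
  have hgn := hfg.norm_le
  have hhn := hgh.norm_le
  have hgm := hfg.exists_mul
  have hhm := hgh.exists_mul
  obtain ⟨A, B, hBA, hA, hB, h1, h2, h3, h4⟩ := hfg
  obtain ⟨E, F, hFE, hE, hF, e1, e2, e3, e4⟩ := hgh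
  -- If `F` leaves `A`, then `g` vanishes somewhere on the greedy set `F`, which forces every
  -- coordinate of `h` to vanish.
  by_cases hFA : F ⊆ A
  swap
  · obtain ⟨m, hmF, hmA⟩ := Set.not_subset.1 hFA
    refine .of_coord_eq_zero f fun n => norm_le_zero_iff.1 ?_
    have h0 : ‖b.coord m g‖ = 0 := by simp [h4 m hmA]
    by_cases hn : n ∈ F
    · exact (e2 n hn m hmF).trans h0.le
    · exact (hhn n).trans ((hF m hmF n hn).trans h0.le)
  -- Levelling may push coordinates of `B` below others, so `E` may discard them. Such indices are
  -- kept in both sets and count as levelled down to zero.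
  refine ⟨B ∪ E ∩ A, B ∪ F, ?_, ?_, ?_, fun n _ => ?_, ?_, ?_, ?_⟩
  · exact Set.union_subset_union_right _ (Set.subset_inter hFE hFA)
  · rintro n hn k hk
    simp only [Set.mem_union, Set.mem_inter_iff, not_or, not_and] at hn hk
    by_cases hnB : n ∈ B
    · exact hB n hnB k hk.1
    have hnEA := hn.resolve_left hnB
    by_cases hkA : k ∈ A
    · have hkE : k ∉ E := fun h => hk.2 h hkA
      rw [← h3 k hkA hk.1]
      exact (hE n hnEA.1 k hkE).trans (hgn n)
    · exact hA n hnEA.2 k hkA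
  · rintro n hn k hk
    simp only [Set.mem_union, not_or] at hn hk
    by_cases hnB : n ∈ B
    · exact hB n hnB k hk.1
    have hnF := hn.resolve_left hnB
    by_cases hkA : k ∈ A
    · rw [← h3 k hkA hk.1]
      exact (hF n hnF k hk.2).trans (hgn n)
    · exact hA n (hFA hnF) k hkA
  · obtain ⟨c, hc, hc'⟩ := hgm n
    obtain ⟨d, hd, hd'⟩ := hhm n
    exact ⟨d * c, mul_nonneg hd hc, by rw [hd', hc', RCLike.ofReal_mul, mul_assoc]⟩
  · intro n hn m hm
    by_cases hnB : n ∈ B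
    · by_cases hmB : m ∈ B
      · exact (hhn n).trans (h2 n hnB m hmB)
      · have hmF := hm.resolve_left hmB
        refine le_trans ?_ (hgn m)
        by_cases hnF : n ∈ F
        · exact e2 n hnF m hmF
        · exact (hhn n).trans (hF m hmF n hnF)
    · by_cases hmF : m ∈ F
      · exact (e2 n (hn.resolve_left hnB) m hmF).trans (hgn m)
      · exact ((hhn n).trans (hgn n)).trans (hB m (hm.resolve_right hmF) n hnB)
  · intro n hn hn'
    simp only [Set.mem_union, Set.mem_inter_iff, not_or] at hn hn'
    have hnEA := hn.resolve_left hn'.1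
    rw [e3 n hnEA.1 hn'.2, h3 n hnEA.2 hn'.1]
  · intro n hn
    simp only [Set.mem_union, Set.mem_inter_iff, not_or, not_and] at hn
    by_cases hnE : n ∈ E
    · have := h4 n (hn.2 hnE)
      exact norm_le_zero_iff.1 ((hhn n).trans (by simp [this]))
    · exact e4 n hnE

theorem isReduction_proj_sdiff {f : X} {A B : Finset ℕ} (hA : b.IsGreedySet f A)
    (hB : b.IsGreedySet f B) (hBA : B ⊆ A) : b.IsReduction f (b.proj (A \ B) f) := by
  refine ⟨A, B, by simpa using hBA, hA, hB, fun n hn => ⟨0, le_rfl, ?_⟩, fun n hn m hm => ?_,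
    fun n hn hn' => ?_, fun n hn => ?_⟩ <;> simp_all [coord_proj]

theorem isReduction_truncation {f : X} {A : Finset ℕ} (hA : b.IsGreedySet f A) :
    b.IsReduction f (b.truncation f A) := by
  refine ⟨Set.univ, A, by simp, isGreedySet_univ f, hA, fun n hn => ?_, fun n hn m hm => ?_,
    fun n _ hn => ?_, fun n hn => absurd trivial hn⟩
  · rw [coord_truncation, if_pos (by simpa using hn)]
    exact minCoord_mul_sign (by simpa using hn)
  · rw [coord_truncation, if_pos (by simpa using hn), norm_minCoord_mul_sign]
    exact minCoord_le f (by simpa using hm)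
  · rw [coord_truncation, if_neg (by simpa using hn)]

/-- On `B` the coefficients of `g` keep the signs of `f` and lie below its minimum there, so the
truncation estimate applies. The rest is a difference of two greedy projections of `f`. -/
theorem QuasiGreedyWith.exists_reduction_le [IsTopologicalAddGroup X] (hq : IsQuasiNorm 𝕜 q)
    (hqX : InducesTopology q) {a : ℝ} (ha : 0 < a) (hab : b.CoordBounded q a) {C : ℝ}
    (hC0 : 1 ≤ C) (hC : b.QuasiGreedyWith q C) :
    ∃ K : ℝ, 1 ≤ K ∧ ∀ f g, b.IsReduction f g → q g ≤ K * q f := by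
  obtain ⟨κ, hκ, h⟩ := hq.add_le
  have htot := hC.isTotal hq hqX (by linarith)
  obtain ⟨K, hK, hKs⟩ := hC.exists_sum_le hq hC0
  obtain ⟨W, hW, hWs⟩ := hC.exists_truncation_le hq hC0
  refine ⟨κ * (2 * κ * C + K * W), ?_, ?_⟩
  · have h1 : 1 ≤ κ * C := one_le_mul_of_one_le_of_one_le hκ hC0
    have h2 : 0 ≤ K * W := by positivity
    exact one_le_mul_of_one_le_of_one_le hκ (by linarith)
  rintro f g ⟨A, B, hBA, hA, hB, h1, h2, h3, h4⟩
  have hf0 := hq.nonneg f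
  rcases B.finite_or_infinite with hBf | hBi
  swap
  · have h5 : ∀ n, ‖b.coord n g‖ ≤ 0 := fun n => by
      refine b.eq_zero_of_infinite_le hqX ha hab hBi (f := f) fun m hm => ?_
      by_cases hn : n ∈ B
      · exact h2 n hn m hm
      by_cases hnA : n ∈ A
      · rw [h3 n hnA hn]
        exact hB m hm n hn
      · simp [h4 n hnA]
    rw [htot g fun n => norm_le_zero_iff.1 (h5 n), hq.map_zero]
    positivity
  lift B to Finset ℕ using hBf
  have h6 : q (b.proj B g) ≤ K * W * q f := by
    rcases B.eq_empty_or_nonempty with rfl | hne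
    · rw [proj_empty, hq.map_zero]
      positivity
    have e1 : b.proj B g =
        ∑ n ∈ B, ((‖b.coord n g‖ : 𝕜) * scalarSign (b.coord n f)) • b.vec n := by
      refine Finset.sum_congr rfl fun n hn => ?_
      obtain ⟨c, hc, hc'⟩ := h1 n hn
      rw [hc', norm_mul, RCLike.norm_ofReal, abs_of_nonneg hc, RCLike.ofReal_mul, mul_assoc,
        norm_smul_scalarSign]
    have e2 := hKs B (fun n => scalarSign (b.coord n f)) (fun n => norm_scalarSign _)
      (b.minCoord f B) (fun n => ‖b.coord n g‖) (minCoord_nonneg f B)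
      fun n hn => ⟨norm_nonneg _, le_minCoord hne fun m hm => h2 n hn m hm⟩
    rw [e1, mul_assoc]
    refine e2.trans (mul_le_mul_of_nonneg_left ?_ (by linarith))
    exact hWs f B hB _ (minCoord_nonneg f B) fun n hn => minCoord_le f hn
  have h7 : q (g - b.proj B g) ≤ 2 * κ * C * q f := by
    rcases A.finite_or_infinite with hAf | hAi
    · lift A to Finset ℕ using hAf
      have : g - b.proj B g = b.proj (A \ B) f := htot.ext fun n => by
        rw [coord_sub_proj, coord_proj]
        simp only [Finset.mem_sdiff]
        split_ifs with i1 i2 i2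
        · exact absurd i1 i2.2
        · rfl
        · exact h3 n i2.1 (by simpa using i2.2)
        · exact h4 n (by simp_all)
      rw [this]
      exact hC.proj_sdiff_le hq (by linarith) h hA hB (by simpa using hBA)
    -- An infinite greedy set contains the whole support of `f`, since the coordinates tend to zero.
    · have : g - b.proj B g = f - b.proj B f := htot.ext fun n => by
        rw [coord_sub_proj, coord_sub_proj]
        split_ifs with i1
        · rfl
        by_cases hnA : n ∈ A
        · exact h3 n hnA (by simpa using i1)
        · rw [h4 n hnA, eq_comm, ← norm_le_zero_iff]
          exact b.eq_zero_of_infinite_le hqX ha hab hAi (f := f) fun m hm => hA m hm n hnA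
      rw [this]
      calc _ ≤ κ * (q f + C * q f) := (hq.sub_le h _ _).trans (by gcongr; exact hC f B hB)
        _ ≤ κ * (C * q f + C * q f) := by
          gcongr
          exact le_mul_of_one_le_left hf0 hC0
        _ = _ := by ring
  calc q g = q ((g - b.proj B g) + b.proj B g) := by simp
    _ ≤ κ * (2 * κ * C * q f + K * W * q f) := (h _ _).trans (by gcongr)
    _ = _ := by ring

theorem IsQuasiGreedy.exists_quasiGreedyWith (hq : IsQuasiNorm 𝕜 q) (h : b.IsQuasiGreedy q) :
    ∃ C, 1 ≤ C ∧ b.QuasiGreedyWith q C := by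
  obtain ⟨-, -, C, hC⟩ := h
  refine ⟨max C 1, le_max_right _ _, fun f A hA => (hC f A hA).trans ?_⟩
  gcongr
  · exact hq.nonneg f
  · exact le_max_left _ _

/-- A quasi-greedy basis is isometrically quasi-greedy under an equivalent quasi-norm. -/
theorem IsQuasiGreedy.exists_renorming [IsTopologicalAddGroup X] (hq : IsQuasiNorm 𝕜 q)
    (hqX : InducesTopology q) (hb : b.IsQuasiGreedy q) :
    ∃ (q₀ : X → ℝ) (K : ℝ), IsRenorming 𝕜 q₀ ∧ 0 < K ∧ (∀ f, q f ≤ q₀ f) ∧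
      (∀ f, q₀ f ≤ K * q f) ∧ b.IsQuasiGreedyConst q₀ 1 ∧
        b.IsTruncationConst q₀ 1 ∧ b.IsRestrictedTruncationConst q₀ 1 := by
  obtain ⟨a, ha, hab⟩ := b.exists_coordBounded hq hb.1 hb.2.1
  obtain ⟨C, hC0, hC⟩ := hb.exists_quasiGreedyWith hq
  obtain ⟨K, hK, hKs⟩ := hC.exists_reduction_le hq hqX ha hab hC0
  let S : X → Set ℝ := fun f => {r | ∃ g, b.IsReduction f g ∧ r = q g}
  let q₀ : X → ℝ := fun f => sSup (S f)
  have hbdd : ∀ f, BddAbove (S f) := fun f =>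
    ⟨K * q f, by rintro _ ⟨g, hg, rfl⟩; exact hKs f g hg⟩
  have hne : ∀ f, (S f).Nonempty := fun f => ⟨_, f, .refl f, rfl⟩
  have hle : ∀ f, q f ≤ q₀ f := fun f => le_csSup (hbdd f) ⟨f, .refl f, rfl⟩
  have hge : ∀ f, q₀ f ≤ K * q f := fun f =>
    csSup_le (hne f) (by rintro _ ⟨g, hg, rfl⟩; exact hKs f g hg)
  -- By transitivity the reductions of `g` are among those of `f`; this yields all the contractivity
  -- claims.
  have hmono : ∀ f g, b.IsReduction f g → q₀ g ≤ q₀ f := fun f g hfg =>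
    csSup_le_csSup (hbdd f) (hne g) (by rintro _ ⟨h, hgh, rfl⟩; exact ⟨h, hfg.trans hgh, rfl⟩)
  have hsmul : ∀ (t : 𝕜) f, q₀ (t • f) = ‖t‖ * q₀ f := by
    refine map_smul_eq_of_map_smul_le (fun f => (hq.nonneg f).trans (hle f)) fun t f => ?_
    rcases eq_or_ne t 0 with rfl | ht
    · simpa [hq.map_zero] using hge 0
    refine csSup_le (hne _) ?_
    rintro _ ⟨g, hg, rfl⟩
    have h1 := hg.smul t⁻¹
    rw [smul_smul, inv_mul_cancel₀ ht, one_smul] at h1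
    have h2 : q (t⁻¹ • g) ≤ q₀ f := le_csSup (hbdd f) ⟨_, h1, rfl⟩
    rwa [hq.smul, norm_inv, inv_mul_le_iff₀ (norm_pos_iff.2 ht)] at h2
  have hren := hq.isRenorming_of_equiv hqX hsmul (by linarith : 0 < K) one_pos hge
    (fun f => by simpa using hle f)
  have h1 : ∀ (f : X) (A B : Finset ℕ), b.IsGreedySet f A → b.IsGreedySet f B → B ⊆ A →
      q₀ (b.proj (A \ B) f) ≤ q₀ f := fun f A B hA hB hBA =>
    hmono _ _ (isReduction_proj_sdiff hA hB hBA)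
  have h2 : ∀ (f : X) (A : Finset ℕ), b.IsGreedySet f A → q₀ (b.truncation f A) ≤ q₀ f :=
    fun f A hA => hmono _ _ (isReduction_truncation hA)
  exact ⟨q₀, K, hren, by linarith, hle, hge, isQuasiGreedyConst_one hren.1 h1,
    isTruncationConst_one hren.1 h2,
    isRestrictedTruncationConst_one hren.1 (restrictedTruncation_le h1 h2)⟩

end CompleteMBasis

namespace CompleteMBasis

variable {𝕜 : Type*} [RCLike 𝕜] {X : Type*} [AddCommGroup X] [Module 𝕜 X] [TopologicalSpace X]
  {b : CompleteMBasis 𝕜 X} {q : X → ℝ}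

/-! ### Almost greedy bases -/

theorem IsAlmostGreedy.exists_almostGreedyWith (hq : IsQuasiNorm 𝕜 q) (h : b.IsAlmostGreedy q) :
    ∃ C, 1 ≤ C ∧ b.AlmostGreedyWith q C := by
  obtain ⟨-, -, C, hC⟩ := h
  refine ⟨max C 1, le_max_right _ _, fun f A B hA hBA => (hC f A B hA hBA).trans ?_⟩
  gcongr
  · exact hq.nonneg _
  · exact le_max_left _ _

theorem AlmostGreedyWith.exists_quasiGreedyWith (hq : IsQuasiNorm 𝕜 q) {C : ℝ} (hC0 : 1 ≤ C)
    (hC : b.AlmostGreedyWith q C) : ∃ C', 1 ≤ C' ∧ b.QuasiGreedyWith q C' := by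
  obtain ⟨κ, hκ, h⟩ := hq.add_le
  refine ⟨κ * (1 + C), one_le_mul_of_one_le_of_one_le hκ (by linarith), fun f A hA => ?_⟩
  have h1 := hC f A ∅ hA (by simp)
  rw [proj_empty, sub_zero] at h1
  calc q (b.proj A f) = q (f - (f - b.proj A f)) := by simp
    _ ≤ κ * (q f + C * q f) := (hq.sub_le h _ _).trans (by gcongr)
    _ = _ := by ring

theorem IsAlmostGreedy.isQuasiGreedy (hq : IsQuasiNorm 𝕜 q) (h : b.IsAlmostGreedy q) :
    b.IsQuasiGreedy q := by
  obtain ⟨C, hC0, hC⟩ := h.exists_almostGreedyWith hq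
  obtain ⟨C', -, hC'⟩ := hC.exists_quasiGreedyWith hq hC0
  exact ⟨h.1, h.2.1, C', hC'⟩

/-- In the sum of the two vectors `B` is a greedy set; removing `B` leaves one summand and removing
`A` the other. -/
theorem AlmostGreedyWith.sum_le_of_disjoint {C : ℝ} (hC : b.AlmostGreedyWith q C)
    {A B : Finset ℕ} (hAB : Disjoint A B) (hc : A.card ≤ B.card) {ε δ : ℕ → 𝕜}
    (hε : ∀ n, ‖ε n‖ = 1) (hδ : ∀ n, ‖δ n‖ = 1) :
    q (∑ n ∈ A, ε n • b.vec n) ≤ C * q (∑ n ∈ B, δ n • b.vec n) := by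
  rw [Finset.disjoint_left] at hAB
  set F := ∑ n ∈ A, ε n • b.vec n + ∑ n ∈ B, δ n • b.vec n with hF
  have hcoord : ∀ k, b.coord k F = (if k ∈ A then ε k else 0) + if k ∈ B then δ k else 0 :=
    fun k => by rw [hF, map_add, coord_sum, coord_sum]
  have hA : b.proj A F = ∑ n ∈ A, ε n • b.vec n :=
    Finset.sum_congr rfl fun n hn => by simp [hcoord, hn, hAB hn]
  have hB : b.proj B F = ∑ n ∈ B, δ n • b.vec n :=
    Finset.sum_congr rfl fun n hn => by
      have : n ∉ A := fun h => hAB h hn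
      simp [hcoord, hn, this]
  have h1 : b.IsGreedySet F B := fun n hn k hk => by
    have h2 : n ∉ A := fun h => hAB h hn
    simp only [Finset.mem_coe] at hn hk
    simp only [hcoord, hn, hk, h2, if_true, if_false, zero_add, add_zero, hδ]
    split_ifs <;> simp [hε]
  have h2 := hC F B A h1 hc
  rw [hA, hB] at h2
  simpa [hF] using h2

/-- Overlapping sets are compared through a third set disjoint from both, hence the second factor
`C`. -/
theorem AlmostGreedyWith.sum_le {C : ℝ} (hC0 : 0 ≤ C) (hC : b.AlmostGreedyWith q C)
    {A B : Finset ℕ} (hc : A.card ≤ B.card) {ε δ : ℕ → 𝕜}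
    (hε : ∀ n, ‖ε n‖ = 1) (hδ : ∀ n, ‖δ n‖ = 1) :
    q (∑ n ∈ A, ε n • b.vec n) ≤ C * C * q (∑ n ∈ B, δ n • b.vec n) := by
  obtain ⟨D, hD, hDc⟩ := (A ∪ B).finite_toSet.infinite_compl.exists_subset_card_eq B.card
  have h1 : Disjoint A D := Finset.disjoint_left.2 fun n hn hnD => hD hnD (by simp [hn])
  have h2 : Disjoint D B := Finset.disjoint_left.2 fun n hnD hn => hD hnD (by simp [hn])
  calc _ ≤ C * q (∑ n ∈ D, ε n • b.vec n) := hC.sum_le_of_disjoint h1 (hc.trans hDc.ge) hε hε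
    _ ≤ C * (C * q (∑ n ∈ B, δ n • b.vec n)) := by
      gcongr
      exact hC.sum_le_of_disjoint h2 hDc.le hε hδ
    _ = _ := by ring

/-! ### Replacements -/

theorem mem_replacements {f : X} {D : Finset ℕ} {z : X} :
    (D, z) ∈ b.replacements f ↔ (∀ n ∈ D, b.coord n f ≠ 0) ∧
      (∀ n, b.coord n f ≠ 0 → n ∉ D → b.coord n z = 0) ∧
      (D.card : ℕ∞) ≤ (b.supp z).encard ∧
      ∀ n m, b.coord m z ≠ 0 → ‖b.coord n f‖ ≤ ‖b.coord m z‖ := by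
  refine and_congr Iff.rfl (and_congr ?_ Iff.rfl)
  rw [Set.eq_empty_iff_forall_notMem]
  refine forall_congr' fun n => ?_
  simp only [supp, Set.mem_inter_iff, Set.mem_sdiff, Set.mem_ofPred_eq, Finset.mem_coe]
  tauto

theorem zero_mem_replacements (f : X) : (∅, 0) ∈ b.replacements f := by
  simp [mem_replacements]

theorem coord_replacement {f : X} {D : Finset ℕ} {z : X} (h : (D, z) ∈ b.replacements f) (n : ℕ) :
    (b.coord n z ≠ 0 → b.coord n (f - b.proj D f + z) = b.coord n z) ∧
      (n ∉ D → b.coord n z = 0 → b.coord n (f - b.proj D f + z) = b.coord n f) ∧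
      (n ∈ D → b.coord n z = 0 → b.coord n (f - b.proj D f + z) = 0) := by
  rw [mem_replacements] at h
  rw [map_add, coord_sub_proj]
  have h1 : b.coord n z ≠ 0 → n ∉ D → b.coord n f = 0 := fun hz hn =>
    by_contra fun hf => hz (h.2.1 n hf hn)
  refine ⟨fun hz => ?_, fun hn hz => by simp [hn, hz], fun hn hz => by simp [hn, hz]⟩
  split_ifs with hn
  · simp
  · simp [h1 hz hn]

/-- The coordinates of `z` on its support dominate all those of `f`, so they go on top of what
survives of `E`. -/
theorem isGreedySet_replacement {f : X} {D : Finset ℕ} {z : X} (h : (D, z) ∈ b.replacements f)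
    {E : Set ℕ} (hE : b.IsGreedySet f E) :
    b.IsGreedySet (f - b.proj D f + z) (b.supp z ∪ E \ D) := by
  intro n hn k hk
  obtain ⟨n1, n2, n3⟩ := coord_replacement h n
  obtain ⟨k1, k2, k3⟩ := coord_replacement h k
  rw [mem_replacements] at h
  simp only [supp, Set.mem_union, Set.mem_sdiff, Set.mem_ofPred_eq, Finset.mem_coe, not_or,
    not_and, not_not] at hn hk
  by_cases hkD : k ∈ D
  · simp [k3 hkD hk.1]
  rw [k2 hkD hk.1]
  by_cases hnz : b.coord n z = 0
  · have hnE := hn.resolve_left (by simpa using hnz)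
    rw [n2 hnE.2 hnz]
    exact hE n hnE.1 k fun hkE => hkD (hk.2 hkE)
  · rw [n1 hnz]
    exact h.2.2.2 k n hnz

theorem eq_zero_of_infinite_supp [IsTopologicalAddGroup X] (hqX : InducesTopology q)
    {a : ℝ} (ha : 0 < a) (hab : b.CoordBounded q a) (htot : b.IsTotal) {f : X} {D : Finset ℕ}
    {z : X} (h : (D, z) ∈ b.replacements f) (hz : (b.supp z).Infinite) : f = 0 :=
  htot f fun n => norm_le_zero_iff.1 <|
    b.eq_zero_of_infinite_le hqX ha hab hz fun m hm => (mem_replacements.1 h).2.2.2 n m hm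

theorem almostGreedyNorm_le (hq : IsQuasiNorm 𝕜 q) {f : X} {D : Finset ℕ} {z : X}
    (h : (D, z) ∈ b.replacements f) : b.almostGreedyNorm q f ≤ q (f - b.proj D f + z) :=
  csInf_le ⟨0, by rintro _ ⟨_, _, rfl⟩; exact hq.nonneg _⟩ ⟨_, h, rfl⟩

theorem le_almostGreedyNorm {f : X} {r : ℝ}
    (h : ∀ D z, (D, z) ∈ b.replacements f → r ≤ q (f - b.proj D f + z)) :
    r ≤ b.almostGreedyNorm q f :=
  le_csInf ⟨_, _, zero_mem_replacements f, rfl⟩ (by rintro _ ⟨⟨D, z⟩, hp, rfl⟩; exact h D z hp)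

theorem almostGreedyNorm_le_self (hq : IsQuasiNorm 𝕜 q) (f : X) :
    b.almostGreedyNorm q f ≤ q f := by
  simpa using almostGreedyNorm_le hq (zero_mem_replacements f)

theorem almostGreedyNorm_nonneg (hq : IsQuasiNorm 𝕜 q) (f : X) : 0 ≤ b.almostGreedyNorm q f :=
  le_almostGreedyNorm fun _ _ _ => hq.nonneg _

theorem almostGreedyNorm_mono (hq : IsQuasiNorm 𝕜 q) {f g : X}
    (h : ∀ D z, (D, z) ∈ b.replacements f → ∃ D' z', (D', z') ∈ b.replacements g ∧
      q (g - b.proj D' g + z') ≤ q (f - b.proj D f + z)) :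
    b.almostGreedyNorm q g ≤ b.almostGreedyNorm q f :=
  le_almostGreedyNorm fun D z hD => by
    obtain ⟨D', z', h1, h2⟩ := h D z hD
    exact (almostGreedyNorm_le hq h1).trans h2

theorem smul_mem_replacements {f : X} {D : Finset ℕ} {z : X} (h : (D, z) ∈ b.replacements f)
    {t : 𝕜} (ht : t ≠ 0) : (D, t • z) ∈ b.replacements (t • f) := by
  have hs : b.supp (t • z) = b.supp z := by
    ext n
    simp [supp, ht]
  rw [mem_replacements] at h ⊢
  rw [hs]
  refine ⟨fun n hn => by simpa [ht] using h.1 n hn, fun n hn hn' => ?_, h.2.2.1, fun n m hm => ?_⟩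
  · rw [map_smul, h.2.1 n (by simp_all) hn', smul_zero]
  · simpa [norm_smul] using
      mul_le_mul_of_nonneg_left (h.2.2.2 n m (by simp_all)) (norm_nonneg t)

theorem almostGreedyNorm_smul (hq : IsQuasiNorm 𝕜 q) (t : 𝕜) (f : X) :
    b.almostGreedyNorm q (t • f) = ‖t‖ * b.almostGreedyNorm q f := by
  refine map_smul_eq_of_map_smul_le (almostGreedyNorm_nonneg hq) (fun t f => ?_) t f
  rcases eq_or_ne t 0 with rfl | ht
  · simpa [hq.map_zero] using almostGreedyNorm_le_self (b := b) hq (0 : X)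
  rw [← inv_mul_le_iff₀ (norm_pos_iff.2 ht)]
  refine le_almostGreedyNorm fun D z h => ?_
  rw [inv_mul_le_iff₀ (norm_pos_iff.2 ht), ← hq.smul, smul_add, smul_sub, ← proj_smul]
  exact almostGreedyNorm_le hq (smul_mem_replacements h ht)

/-- Let `g` be the replaced vector and `Z` the support of `z`, a greedy set of `g`. Then `f - S_D(f)
= g - S_Z(g)` is controlled by quasi-greediness. The coefficients of `S_D(f)` lie below the minimum
of `z` on `Z`, so democracy moves the sign sum from `D` to `Z`, where the truncation estimate for
`g` applies. -/
theorem AlmostGreedyWith.exists_le_replacement [IsTopologicalAddGroup X] (hq : IsQuasiNorm 𝕜 q)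
    (hqX : InducesTopology q) {a : ℝ} (ha : 0 < a) (hab : b.CoordBounded q a) {C : ℝ}
    (hC0 : 1 ≤ C) (hC : b.AlmostGreedyWith q C) :
    ∃ L : ℝ, 0 < L ∧ ∀ f D z, (D, z) ∈ b.replacements f → q f ≤ L * q (f - b.proj D f + z) := by
  obtain ⟨κ, hκ, h⟩ := hq.add_le
  obtain ⟨Q, hQ0, hQ⟩ := hC.exists_quasiGreedyWith hq hC0
  have htot := hQ.isTotal hq hqX (by linarith)
  obtain ⟨K, hK, hKs⟩ := hQ.exists_sum_le hq hQ0
  obtain ⟨W, hW, hWs⟩ := hQ.exists_truncation_le hq hQ0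
  refine ⟨κ * (κ * (1 + Q) + K * (C * C * W)), by positivity, fun f D z hD => ?_⟩
  set g := f - b.proj D f + z with hg
  have hg0 := hq.nonneg g
  by_cases hz : (b.supp z).Infinite
  · rw [eq_zero_of_infinite_supp hqX ha hab htot hD hz, hq.map_zero]
    positivity
  have hgreedy := isGreedySet_replacement hD (isGreedySet_empty f)
  have hcoord := coord_replacement hD
  rw [← hg] at hgreedy hcoord
  rw [mem_replacements] at hD
  obtain ⟨Z, hZ⟩ := (Set.not_infinite.1 hz).exists_finset_coe
  have hmem : ∀ n, n ∈ Z ↔ b.coord n z ≠ 0 := fun n => by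
    rw [← Finset.mem_coe, hZ]
    rfl
  have hcard : D.card ≤ Z.card := by
    have := hD.2.2.1
    rw [← hZ, Set.encard_coe_eq_coe_finsetCard] at this
    exact_mod_cast this
  have hZg : b.IsGreedySet g Z := by
    rw [hZ]
    simpa using hgreedy
  have h1 : q (f - b.proj D f) ≤ κ * (1 + Q) * q g := by
    have : f - b.proj D f = g - b.proj Z g := htot.ext fun n => by
      rw [coord_sub_proj, coord_sub_proj]
      obtain ⟨n1, n2, n3⟩ := hcoord n
      by_cases hz : b.coord n z = 0
      · rw [if_neg (show n ∉ Z by simp [hmem, hz])]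
        split_ifs with hn
        · exact (n3 hn hz).symm
        · exact (n2 hn hz).symm
      · rw [if_pos (show n ∈ Z from (hmem n).2 hz)]
        split_ifs with hn
        · rfl
        · exact by_contra fun hf => hz (hD.2.1 n hf hn)
    rw [this]
    calc _ ≤ κ * (q g + Q * q g) := (hq.sub_le h _ _).trans (by gcongr; exact hQ g Z hZg)
      _ = _ := by ring
  have h2 : q (b.proj D f) ≤ K * (C * C * W) * q g := by
    rcases D.eq_empty_or_nonempty with rfl | hne
    · rw [proj_empty, hq.map_zero]
      positivity
    have hZne : Z.Nonempty := Finset.card_pos.1 (hne.card_pos.trans_le hcard)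
    have hmin : ∀ n, ‖b.coord n f‖ ≤ b.minCoord z Z := fun n =>
      le_minCoord hZne fun m hm => hD.2.2.2 n m ((hmem m).1 hm)
    have e1 : b.proj D f =
        ∑ n ∈ D, ((‖b.coord n f‖ : 𝕜) * scalarSign (b.coord n f)) • b.vec n :=
      Finset.sum_congr rfl fun n hn => by rw [norm_smul_scalarSign]
    have e2 := hKs D (fun n => scalarSign (b.coord n f)) (fun n => norm_scalarSign _)
      (b.minCoord z Z) (fun n => ‖b.coord n f‖) (minCoord_nonneg z Z)
      fun n hn => ⟨norm_nonneg _, hmin n⟩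
    have e3 := hC.sum_le (by linarith) hcard (fun n => norm_scalarSign (b.coord n f))
      (fun n => norm_scalarSign (b.coord n g))
    have e4 := hWs g Z hZg _ (minCoord_nonneg z Z) fun n hn => by
      rw [(hcoord n).1 ((hmem n).1 hn)]
      exact minCoord_le z hn
    rw [e1]
    calc _ ≤ _ := e2
      _ ≤ K * (b.minCoord z Z * (C * C * q (∑ n ∈ Z, scalarSign (b.coord n g) • b.vec n))) := by
        gcongr
        exact minCoord_nonneg z Z
      _ = K * (C * C * (b.minCoord z Z * q (∑ n ∈ Z, scalarSign (b.coord n g) • b.vec n))) := by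
        ring
      _ ≤ K * (C * C * (W * q g)) := by gcongr
      _ = _ := by ring
  calc q f = q (f - b.proj D f + b.proj D f) := by simp
    _ ≤ κ * (κ * (1 + Q) * q g + K * (C * C * W) * q g) := (h _ _).trans (by gcongr)
    _ = _ := by ring

theorem AlmostGreedyWith.isRenorming_almostGreedyNorm [IsTopologicalAddGroup X]
    (hq : IsQuasiNorm 𝕜 q) (hqX : InducesTopology q) {a : ℝ} (ha : 0 < a)
    (hab : b.CoordBounded q a) {C : ℝ} (hC0 : 1 ≤ C) (hC : b.AlmostGreedyWith q C) :
    IsRenorming 𝕜 (b.almostGreedyNorm q) := by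
  obtain ⟨L, hL, h⟩ := hC.exists_le_replacement hq hqX ha hab hC0
  refine hq.isRenorming_of_equiv hqX (almostGreedyNorm_smul hq) one_pos hL
    (fun f => by simpa using almostGreedyNorm_le_self hq f) fun f => ?_
  rw [← inv_mul_le_iff₀ hL]
  refine le_almostGreedyNorm fun D z hD => ?_
  rw [inv_mul_le_iff₀ hL]
  exact h f D z hD

/-! ### The constants of `almostGreedyNorm` -/

theorem IsGreedySet.supp_subset {f : X} {A : Set ℕ} (hA : b.IsGreedySet f A) {n : ℕ}
    (hn : n ∈ A) (hn0 : b.coord n f = 0) {k : ℕ} (hk : k ∉ A) : b.coord k f = 0 := by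
  simpa [hn0] using hA n hn k hk

/-- A replacement of `f - S_B(f)` is read as a replacement of `f - S_A(f)` producing the same
vector: what `A` removed and the old vector still contains is put into `z`, and what the old vector
lacks is put into `D`. -/
theorem almostGreedyWith_almostGreedyNorm (hq : IsQuasiNorm 𝕜 q) (htot : b.IsTotal) :
    b.AlmostGreedyWith (b.almostGreedyNorm q) 1 := by
  intro f A B hA hBA
  rw [one_mul]
  by_cases hAf : ∀ n ∈ A, b.coord n f ≠ 0
  swap
  · push Not at hAf
    obtain ⟨n, hn, hn0⟩ := hAf
    have : f - b.proj A f = 0 := htot _ fun k => by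
      rw [coord_sub_proj]
      split_ifs with hk
      · rfl
      · exact hA.supp_subset hn hn0 hk
    rw [this]
    refine le_trans ?_ (almostGreedyNorm_nonneg hq _)
    simpa [hq.map_zero] using almostGreedyNorm_le_self (b := b) hq (0 : X)
  refine almostGreedyNorm_mono hq fun D z hD => ?_
  rw [mem_replacements] at hD
  obtain ⟨d1, d2, d3, d4⟩ := hD
  simp only [coord_sub_proj] at d1 d2 d4
  -- Removed indices must lie in the support of `f`, so only this part of `B` counts.
  set B' := B.filter (fun n => b.coord n f ≠ 0) with hB'
  have hB'c : B'.card ≤ A.card := (Finset.card_filter_le _ _).trans hBA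
  have hmB : ∀ n, n ∈ B' ↔ n ∈ B ∧ b.coord n f ≠ 0 := fun n => Finset.mem_filter
  have hA1z : ∀ n ∈ A \ (B' ∪ D), b.coord n z = 0 := fun n hn => by
    simp only [Finset.mem_sdiff, Finset.mem_union, not_or, hmB, not_and, not_not] at hn
    have hnB : n ∉ B := fun h => hAf n hn.1 (hn.2.1 h)
    exact d2 n (by simp [hnB, hAf n hn.1]) hn.2.2
  refine ⟨(B' ∪ D) \ A, z + b.proj (A \ (B' ∪ D)) f, mem_replacements.2
    ⟨fun n hn => ?_, fun n hn hn' => ?_, ?_, fun n m hm => ?_⟩, le_of_eq (congrArg q ?_)⟩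
  · rw [Finset.mem_sdiff, Finset.mem_union] at hn
    rw [coord_sub_proj, if_neg hn.2]
    rcases hn.1 with h | h
    · exact ((hmB n).1 h).2
    · have := d1 n h
      simp_all
  · rw [coord_sub_proj] at hn
    have hnA : n ∉ A := fun h => by simp [h] at hn
    rw [if_neg hnA] at hn
    simp only [Finset.mem_sdiff, Finset.mem_union, hmB, not_and, not_not] at hn'
    have hnD : n ∉ B ∧ n ∉ D := by tauto
    rw [map_add, coord_proj, if_neg (by simp [hnA]), d2 n (by simp [hnD.1, hn]) hnD.2, zero_add]
  · have hs : b.supp (z + b.proj (A \ (B' ∪ D)) f) =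
        b.supp z ∪ ((A \ (B' ∪ D) : Finset ℕ) : Set ℕ) := by
      ext n
      simp only [supp, Set.mem_ofPred_eq, map_add, coord_proj, Set.mem_union, Finset.mem_coe]
      by_cases hn : n ∈ A \ (B' ∪ D)
      · simp only [hn, hA1z n hn, if_true, zero_add, or_true, iff_true]
        exact hAf n (Finset.mem_sdiff.1 hn).1
      · simp [hn]
    have hdisj : Disjoint (b.supp z) ((A \ (B' ∪ D) : Finset ℕ) : Set ℕ) :=
      Set.disjoint_left.2 fun n hn hn' => hn (hA1z n hn')
    rw [hs, Set.encard_union_eq hdisj, Set.encard_coe_eq_coe_finsetCard]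
    -- Cancelling the intersection, the required inequality becomes `|B' ∪ D| ≤ |D| + |A|`, which
    -- holds as `|B'| ≤ |A|`.
    have h1 := Finset.card_sdiff_add_card_inter (B' ∪ D) A
    have h2 := Finset.card_sdiff_add_card_inter A (B' ∪ D)
    have h3 := Finset.card_union_le B' D
    rw [Finset.inter_comm] at h2
    calc (((B' ∪ D) \ A).card : ℕ∞) ≤ ((D.card + (A \ (B' ∪ D)).card : ℕ) : ℕ∞) := by
          exact_mod_cast (by omega)
      _ ≤ _ := by
          push_cast
          gcongr
  · rw [map_add, coord_proj] at hm ⊢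
    rw [coord_sub_proj]
    by_cases hnA : n ∈ A
    · simp [hnA]
    rw [if_neg hnA]
    by_cases hmA : m ∈ A \ (B' ∪ D)
    · rw [hA1z m hmA, if_pos hmA, zero_add]
      exact hA m (Finset.mem_sdiff.1 hmA).1 n hnA
    rw [if_neg hmA, add_zero] at hm ⊢
    by_cases hnB : n ∈ B
    -- The bound on `z` says nothing about coordinates erased by `B`. But `n ∈ B \ A` and `|B| ≤
    -- |A|` give some `k ∈ A \ B`, whose coordinate is not erased and dominates that of `n`.
    · have : ∃ k ∈ A, k ∉ B := by
        by_contra! hAB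
        have := Finset.eq_of_subset_of_card_le hAB hBA
        exact hnA (this ▸ hnB)
      obtain ⟨k, hk, hkB⟩ := this
      have := d4 k m hm
      rw [if_neg hkB] at this
      exact (hA k hk n hnA).trans this
    · simpa [hnB] using d4 n m hm
  · refine htot.ext fun k => ?_
    simp only [map_add, coord_sub_proj, coord_proj, Finset.mem_sdiff, Finset.mem_union, hmB]
    by_cases k1 : k ∈ A <;> by_cases k2 : k ∈ B <;> by_cases k3 : k ∈ D <;>
      by_cases k4 : b.coord k f = 0 <;> simp [k1, k2, k3, k4, add_comm]

/-- The same vector is obtained from the truncation by removing all of `A ∪ D` and putting the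
original coordinates on `A \ D` back through `z`. -/
theorem almostGreedyNorm_truncation_le (hq : IsQuasiNorm 𝕜 q) (htot : b.IsTotal) (f : X)
    (A : Finset ℕ) (hA : b.IsGreedySet f A) :
    b.almostGreedyNorm q (b.truncation f A) ≤ b.almostGreedyNorm q f := by
  by_cases hAf : ∀ n ∈ A, b.coord n f ≠ 0
  swap
  · push Not at hAf
    obtain ⟨n, hn, hn0⟩ := hAf
    have hmin : b.minCoord f A = 0 :=
      le_antisymm (by simpa [hn0] using minCoord_le (b := b) f hn) (minCoord_nonneg f A)
    have : b.truncation f A = 0 := htot _ fun k => by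
      rw [coord_truncation, hmin]
      split_ifs with hk
      · simp
      · exact hA.supp_subset hn hn0 hk
    rw [this]
    refine le_trans ?_ (almostGreedyNorm_nonneg hq _)
    simpa [hq.map_zero] using almostGreedyNorm_le_self (b := b) hq (0 : X)
  have hT : ∀ n, ‖b.coord n (b.truncation f A)‖ ≤ ‖b.coord n f‖ := fun n => by
    rw [coord_truncation]
    split_ifs with hn
    · rw [norm_minCoord_mul_sign]
      exact minCoord_le f hn
    · rfl
  have hTA : ∀ n, ∀ m ∈ A, ‖b.coord n (b.truncation f A)‖ ≤ ‖b.coord m f‖ := fun n m hm => by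
    rw [coord_truncation]
    split_ifs with hn
    · rw [norm_minCoord_mul_sign]
      exact minCoord_le f hm
    · exact hA m hm n hn
  refine almostGreedyNorm_mono hq fun D z hD => ?_
  rw [mem_replacements] at hD
  obtain ⟨d1, d2, d3, d4⟩ := hD
  have hzA : ∀ n ∈ A \ D, b.coord n z = 0 := fun n hn => by
    rw [Finset.mem_sdiff] at hn
    exact d2 n (hAf n hn.1) hn.2
  refine ⟨A ∪ D, z + b.proj (A \ D) f, mem_replacements.2
    ⟨fun n hn => ?_, fun n hn hn' => ?_, ?_, fun n m hm => ?_⟩, le_of_eq (congrArg q ?_)⟩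
  · rw [coord_truncation]
    split_ifs with hnA
    · rw [← norm_pos_iff, norm_minCoord_mul_sign]
      obtain ⟨m, hm, hmin⟩ := A.exists_min_image (fun n => ‖b.coord n f‖) ⟨n, hnA⟩
      exact (norm_pos_iff.2 (hAf m hm)).trans_le (le_minCoord ⟨n, hnA⟩ hmin)
    · exact d1 n ((Finset.mem_union.1 hn).resolve_left hnA)
  · rw [Finset.mem_union, not_or] at hn'
    rw [coord_truncation, if_neg hn'.1] at hn
    rw [map_add, coord_proj, if_neg (by simp [hn'.1]), d2 n hn hn'.2, zero_add]
  · have hs : b.supp (z + b.proj (A \ D) f) = b.supp z ∪ ((A \ D : Finset ℕ) : Set ℕ) := by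
      ext n
      simp only [supp, Set.mem_ofPred_eq, map_add, coord_proj, Set.mem_union, Finset.mem_coe]
      by_cases hn : n ∈ A \ D
      · simp only [hn, hzA n hn, if_true, zero_add, or_true, iff_true]
        exact hAf n (Finset.mem_sdiff.1 hn).1
      · simp [hn]
    have hdisj : Disjoint (b.supp z) ((A \ D : Finset ℕ) : Set ℕ) :=
      Set.disjoint_left.2 fun n hn hn' => hn (hzA n hn')
    rw [hs, Set.encard_union_eq hdisj, Set.encard_coe_eq_coe_finsetCard]
    have h1 := Finset.card_sdiff_add_card A D
    calc ((A ∪ D).card : ℕ∞) = ((D.card + (A \ D).card : ℕ) : ℕ∞) := by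
          exact_mod_cast (by omega)
      _ ≤ _ := by
          push_cast
          gcongr
  · rw [map_add, coord_proj] at hm ⊢
    by_cases hmA : m ∈ A \ D
    · rw [hzA m hmA, if_pos hmA, zero_add]
      exact hTA n m (Finset.mem_sdiff.1 hmA).1
    · rw [if_neg hmA, add_zero] at hm ⊢
      exact (hT n).trans (d4 n m hm)
  · refine htot.ext fun k => ?_
    simp only [map_add, coord_sub_proj, coord_proj, coord_truncation, Finset.mem_sdiff,
      Finset.mem_union]
    by_cases k1 : k ∈ A <;> by_cases k3 : k ∈ D <;> simp [k1, k3, add_comm]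

/-- Discard a smallest coordinate repeatedly. -/
theorem exists_isGreedySet_subset (g : X) (G : Finset ℕ) (hG : b.IsGreedySet g G) {k : ℕ}
    (hk : k ≤ G.card) : ∃ H ⊆ G, b.IsGreedySet g H ∧ H.card = k := by
  induction G using Finset.strongInduction with
  | H G ih =>
  rcases hk.eq_or_lt with rfl | hk
  · exact ⟨G, le_rfl, hG, rfl⟩
  obtain ⟨m, hm, hmin⟩ := G.exists_min_image (fun n => ‖b.coord n g‖)
    (Finset.card_pos.1 (by omega))
  obtain ⟨H, h1, h2, h3⟩ := ih (G.erase m) (Finset.erase_ssubset hm) (fun n hn j hj => by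
    rw [Finset.mem_coe, Finset.mem_erase] at hn hj
    rcases eq_or_ne j m with rfl | hjm
    · exact hmin n hn.2
    · exact hG n hn.2 j fun h => hj ⟨hjm, h⟩) (by
    rw [Finset.card_erase_of_mem hm]
    omega)
  exact ⟨H, h1.trans (Finset.erase_subset _ _), h2, h3⟩

/-- Given a replacement `g` of `f`, both `G₀ = Z ∪ B \ D` and `Z ∪ A \ D` are greedy sets of `g`.
Only `|D'|` replacement coordinates are needed for the projection, so keep that many from `G₀`,
leaving a greedy set `H`. The new vector is then the projection of `g` onto `(Z ∪ A \ D) \ H`, and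
`h1` applies to `g`. -/
theorem almostGreedyNorm_proj_sdiff_le_of_supp [IsTopologicalAddGroup X] (hq : IsQuasiNorm 𝕜 q)
    (hqX : InducesTopology q) {a : ℝ} (ha : 0 < a) (hab : b.CoordBounded q a) (htot : b.IsTotal)
    (h1 : ∀ (f : X) (A B : Finset ℕ), b.IsGreedySet f A → b.IsGreedySet f B → B ⊆ A →
      q (b.proj (A \ B) f) ≤ q f) {f : X} {A B : Finset ℕ} (hA : b.IsGreedySet f A)
    (hB : b.IsGreedySet f B) (hBA : B ⊆ A) (hAf : ∀ n ∈ A, b.coord n f ≠ 0) :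
    b.almostGreedyNorm q (b.proj (A \ B) f) ≤ b.almostGreedyNorm q f := by
  refine almostGreedyNorm_mono hq fun D z hD => ?_
  by_cases hz : (b.supp z).Infinite
  · have : b.proj (A \ B) f = f := by
      rw [eq_zero_of_infinite_supp hqX ha hab htot hD hz]
      simp [proj]
    rw [this]
    exact ⟨D, z, hD, le_rfl⟩
  obtain ⟨Z, hZ⟩ := (Set.not_infinite.1 hz).exists_finset_coe
  have hmem : ∀ n, n ∈ Z ↔ b.coord n z ≠ 0 := fun n => by
    rw [← Finset.mem_coe, hZ]
    rfl
  have hgA := isGreedySet_replacement hD hA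
  have hgB := isGreedySet_replacement hD hB
  have hcoord := coord_replacement hD
  rw [mem_replacements] at hD
  obtain ⟨d1, d2, d3, d4⟩ := hD
  set g := f - b.proj D f + z with hg
  rw [← hZ] at hgA hgB
  norm_cast at hgA hgB
  have hcard : D.card ≤ Z.card := by
    rw [← hZ, Set.encard_coe_eq_coe_finsetCard] at d3
    exact_mod_cast d3
  set G₀ := Z ∪ B \ D with hG₀
  set D' := D ∩ (A \ B) with hD'
  have hle : D'.card ≤ G₀.card := (Finset.card_le_card Finset.inter_subset_left).trans
    (hcard.trans (Finset.card_le_card Finset.subset_union_left))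
  obtain ⟨H, hH, hHg, hHc⟩ := exists_isGreedySet_subset g G₀ hgB (Nat.sub_le G₀.card D'.card)
  have hR : (G₀ \ H).card = D'.card := by
    rw [Finset.card_sdiff_of_subset hH]
    omega
  have hgne : ∀ n ∈ G₀, b.coord n g ≠ 0 := fun n hn => by
    rw [hG₀, Finset.mem_union, Finset.mem_sdiff] at hn
    obtain ⟨n1, n2, n3⟩ := hcoord n
    by_cases hnz : b.coord n z = 0
    · have hnB := hn.resolve_left (by simp [hmem, hnz])
      rw [n2 hnB.2 hnz]
      exact hAf n (hBA hnB.1)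
    · rwa [n1 hnz]
  refine ⟨D', b.proj (G₀ \ H) g, mem_replacements.2
    ⟨fun n hn => ?_, fun n hn hn' => ?_, ?_, fun n m hm => ?_⟩, ?_⟩
  · rw [hD', Finset.mem_inter] at hn
    rw [coord_proj, if_pos hn.2]
    exact d1 n hn.1
  · rw [coord_proj] at hn
    have hnAB : n ∈ A \ B := by
      by_contra h
      simp [h] at hn
    rw [if_pos hnAB] at hn
    have hnD : n ∉ D := fun h => hn' (Finset.mem_inter.2 ⟨h, hnAB⟩)
    rw [coord_proj, if_neg]
    simp [hG₀, hmem, d2 n hn hnD, (Finset.mem_sdiff.1 hnAB).2]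
  · have : b.supp (b.proj (G₀ \ H) g) = ((G₀ \ H : Finset ℕ) : Set ℕ) := by
      ext n
      simp only [supp, coord_proj, Set.mem_ofPred_eq, Finset.mem_coe]
      by_cases hn : n ∈ G₀ \ H
      · simp only [hn, if_true, iff_true]
        exact hgne n (Finset.mem_sdiff.1 hn).1
      · simp [hn]
    rw [this, Set.encard_coe_eq_coe_finsetCard, hR]
  · rw [coord_proj] at hm ⊢
    have hmR : m ∈ G₀ \ H := by
      by_contra h
      simp [h] at hm
    rw [coord_proj, if_pos hmR]
    by_cases hn : n ∈ A \ B
    swap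
    · simp [hn]
    rw [if_pos hn]
    rw [Finset.mem_sdiff] at hn
    obtain ⟨m1, m2, m3⟩ := hcoord m
    by_cases hmz : b.coord m z = 0
    · rw [Finset.mem_sdiff, hG₀, Finset.mem_union, Finset.mem_sdiff] at hmR
      have hmB := hmR.1.resolve_left (by simp [hmem, hmz])
      rw [m2 hmB.2 hmz]
      exact hB m hmB.1 n hn.2
    · rw [m1 hmz]
      exact d4 n m hmz
  · have hG : H ⊆ Z ∪ A \ D :=
      hH.trans (Finset.union_subset_union_right (Finset.sdiff_subset_sdiff hBA le_rfl))
    convert h1 g (Z ∪ A \ D) H hgA hHg hG using 2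
    refine htot.ext fun k => ?_
    obtain ⟨k1, k2, k3⟩ := hcoord k
    have k4 := d2 k
    have k5 := hmem k
    have k6 := @hBA k
    have k7 := @hH k
    simp only [map_add, coord_sub_proj, coord_proj, hD', hG₀, Finset.mem_sdiff, Finset.mem_inter,
      Finset.mem_union] at k7 ⊢
    clear * - k1 k2 k3 k4 k5 k6 k7
    generalize b.coord k f = x, b.coord k g = y, b.coord k z = w at *
    grind

theorem isGreedySet_inter_supp {f : X} {A : Finset ℕ} (hA : b.IsGreedySet f A) :
    b.IsGreedySet f ((A.filter fun n => b.coord n f ≠ 0 : Finset ℕ) : Set ℕ) := by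
  intro n hn k hk
  simp only [Finset.coe_filter, Set.mem_ofPred_eq, not_and, not_not] at hn hk
  by_cases hkA : k ∈ A
  · simp [hk hkA]
  · exact hA n hn.1 k hkA

theorem almostGreedyNorm_proj_sdiff_le [IsTopologicalAddGroup X] (hq : IsQuasiNorm 𝕜 q)
    (hqX : InducesTopology q) {a : ℝ} (ha : 0 < a) (hab : b.CoordBounded q a) (htot : b.IsTotal)
    (h1 : ∀ (f : X) (A B : Finset ℕ), b.IsGreedySet f A → b.IsGreedySet f B → B ⊆ A →
      q (b.proj (A \ B) f) ≤ q f) (f : X) (A B : Finset ℕ) (hA : b.IsGreedySet f A)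
    (hB : b.IsGreedySet f B) (hBA : B ⊆ A) :
    b.almostGreedyNorm q (b.proj (A \ B) f) ≤ b.almostGreedyNorm q f := by
  have := almostGreedyNorm_proj_sdiff_le_of_supp hq hqX ha hab htot h1
    (isGreedySet_inter_supp hA) (isGreedySet_inter_supp hB) (Finset.filter_subset_filter _ hBA)
    fun n hn => (Finset.mem_filter.1 hn).2
  convert this using 2
  refine htot.ext fun k => ?_
  simp only [coord_proj, Finset.mem_sdiff, Finset.mem_filter]
  by_cases k1 : b.coord k f = 0 <;> simp [k1]

/-- The properties of the quasi-norm `almostGreedyNorm` of an almost greedy basis. -/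
theorem IsAlmostGreedy.almostGreedyNorm_spec [IsTopologicalAddGroup X] (hq : IsQuasiNorm 𝕜 q)
    (hqX : InducesTopology q) (hb : b.IsAlmostGreedy q) :
    IsRenorming 𝕜 (b.almostGreedyNorm q) ∧
      b.IsAlmostGreedyConst (b.almostGreedyNorm q) 1 ∧
      b.IsTruncationConst (b.almostGreedyNorm q) 1 ∧
      (b.IsQuasiGreedyConst q 1 →
        b.IsQuasiGreedyConst (b.almostGreedyNorm q) 1 ∧
        b.IsRestrictedTruncationConst (b.almostGreedyNorm q) 1) := by
  obtain ⟨a, ha, hab⟩ := b.exists_coordBounded hq hb.1 hb.2.1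
  obtain ⟨C, hC0, hC⟩ := hb.exists_almostGreedyWith hq
  obtain ⟨Q, hQ0, hQ⟩ := hC.exists_quasiGreedyWith hq hC0
  have htot := hQ.isTotal hq hqX (by linarith)
  have hren := hC.isRenorming_almostGreedyNorm hq hqX ha hab hC0
  have hT := almostGreedyNorm_truncation_le hq htot
  refine ⟨hren, isAlmostGreedyConst_one hren.1 (almostGreedyWith_almostGreedyNorm hq htot),
    isTruncationConst_one hren.1 hT, fun h1 => ?_⟩
  have h2 := almostGreedyNorm_proj_sdiff_le hq hqX ha hab htot
    (fun f A B hA hB hBA => by simpa using h1.1 f A B hA hB hBA)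
  exact ⟨isQuasiGreedyConst_one hren.1 h2,
    isRestrictedTruncationConst_one hren.1 (restrictedTruncation_le h2 hT)⟩

end CompleteMBasis

/-- Split the coefficients into real and imaginary parts, and these into positive and negative
parts. -/
theorem IsQuasiNorm.exists_ball_bound {𝕜 : Type*} [RCLike 𝕜] {X : Type*} [AddCommGroup X]
    [Module 𝕜 X] {q : X → ℝ} (hq : IsQuasiNorm 𝕜 q) :
    ∃ K : ℝ, 1 ≤ K ∧ ∀ {ι : Type} (s : Finset ι) (v : ι → X) (M : ℝ),
      (∀ B ⊆ s, q (∑ i ∈ B, v i) ≤ M) → ∀ c : ι → 𝕜, (∀ i ∈ s, ‖c i‖ ≤ 1) →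
        q (∑ i ∈ s, c i • v i) ≤ K * M := by
  obtain ⟨κ, hκ, h⟩ := hq.add_le
  obtain ⟨K, hK, hKs⟩ := hq.exists_cube_bound
  refine ⟨κ * κ * (4 * K), one_le_mul_of_one_le_of_one_le
    (one_le_mul_of_one_le_of_one_le hκ hκ) (by linarith), fun {ι} s v M hM c hc => ?_⟩
  have hM0 : 0 ≤ M := (hq.nonneg _).trans (hM ∅ (by simp))
  have hreal : ∀ r : ι → ℝ, (∀ i ∈ s, |r i| ≤ 1) →
      q (∑ i ∈ s, (r i : 𝕜) • v i) ≤ κ * (2 * K * M) := by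
    intro r hr
    have h1 := hKs s v M hM (fun i => max (r i) 0) fun i hi =>
      ⟨le_max_right _ _, max_le (abs_le.1 (hr i hi)).2 zero_le_one⟩
    have h2 := hKs s v M hM (fun i => max (-r i) 0) fun i hi =>
      ⟨le_max_right _ _, max_le (by linarith [(abs_le.1 (hr i hi)).1]) zero_le_one⟩
    have h3 : ∑ i ∈ s, (r i : 𝕜) • v i = ∑ i ∈ s, ((max (r i) 0 : ℝ) : 𝕜) • v i -
        ∑ i ∈ s, ((max (-r i) 0 : ℝ) : 𝕜) • v i := by
      rw [← Finset.sum_sub_distrib]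
      refine Finset.sum_congr rfl fun i _ => ?_
      rw [← sub_smul, ← RCLike.ofReal_sub, max_zero_sub_max_neg_zero_eq_self]
    rw [h3]
    refine (hq.sub_le h _ _).trans ?_
    gcongr
    linarith
  have h1 := hreal (fun i => RCLike.re (c i)) fun i hi => (RCLike.abs_re_le_norm _).trans (hc i hi)
  have h2 := hreal (fun i => RCLike.im (c i)) fun i hi => (RCLike.abs_im_le_norm _).trans (hc i hi)
  -- Only an inequality, because `RCLike.I` is zero over the reals.
  have hI : ‖(RCLike.I : 𝕜)‖ ≤ 1 := by
    rcases RCLike.I_mul_I_ax (K := 𝕜) with h0 | h0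
    · simp [h0]
    · have : ‖(RCLike.I : 𝕜)‖ * ‖(RCLike.I : 𝕜)‖ = 1 := by rw [← norm_mul, h0]; simp
      nlinarith [norm_nonneg (RCLike.I : 𝕜)]
  have h3 : ∑ i ∈ s, c i • v i = ∑ i ∈ s, ((RCLike.re (c i) : ℝ) : 𝕜) • v i +
      (RCLike.I : 𝕜) • ∑ i ∈ s, ((RCLike.im (c i) : ℝ) : 𝕜) • v i := by
    rw [Finset.smul_sum, ← Finset.sum_add_distrib]
    refine Finset.sum_congr rfl fun i _ => ?_
    rw [smul_smul, ← add_smul, mul_comm RCLike.I, RCLike.re_add_im]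
  rw [h3]
  calc _ ≤ κ * (κ * (2 * K * M) + κ * (2 * K * M)) := by
        refine (h _ _).trans ?_
        rw [hq.smul]
        exact mul_le_mul_of_nonneg_left
          (add_le_add h1 ((mul_le_of_le_one_left (hq.nonneg _) hI).trans h2)) (by linarith)
    _ = _ := by ring

namespace CompleteMBasis

section

variable {𝕜 : Type*} [RCLike 𝕜] {X : Type*} [AddCommGroup X] [Module 𝕜 X] [TopologicalSpace X]
  {b : CompleteMBasis 𝕜 X} {q : X → ℝ}

theorem IsAlmostGreedy.of_equiv (hq : IsQuasiNorm 𝕜 q) {q' : X → ℝ} {K : ℝ} (hK0 : 0 < K)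
    (hle : ∀ f, q f ≤ q' f) (hge : ∀ f, q' f ≤ K * q f) (h : b.IsAlmostGreedy q) :
    b.IsAlmostGreedy q' := by
  obtain ⟨C, hC0, hC⟩ := h.exists_almostGreedyWith hq
  obtain ⟨⟨M, hM⟩, ⟨c, D, hc, hcD⟩, -⟩ := h
  refine ⟨⟨K * M, fun n f hf => ?_⟩, ⟨c, K * D, hc, fun n => ⟨(hcD n).1.trans (hle _), ?_⟩⟩,
    K * C, fun f A B hA hBA => ?_⟩
  · calc _ ≤ K * q (b.vec n) * ‖b.coord n f‖ := by
          gcongr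
          exact hge _
      _ = K * (q (b.vec n) * ‖b.coord n f‖) := by ring
      _ ≤ _ := by
          gcongr
          exact hM n f ((hle f).trans hf)
  · exact (hge _).trans (by gcongr; exact (hcD n).2)
  · calc _ ≤ K * (C * q (f - b.proj B f)) := (hge _).trans (by gcongr; exact hC f A B hA hBA)
      _ ≤ K * (C * q' (f - b.proj B f)) := by
          gcongr
          exact hle _
      _ = _ := by ring

/-! ### Greedy bases -/

theorem IsGreedy.exists_greedyWith (hq : IsQuasiNorm 𝕜 q) (h : b.IsGreedy q) :
    ∃ C, 1 ≤ C ∧ b.GreedyWith q C := by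
  obtain ⟨-, -, C, hC⟩ := h
  refine ⟨max C 1, le_max_right _ _, fun f z A hA hz => (hC f z A hA hz).trans ?_⟩
  gcongr
  · exact hq.nonneg _
  · exact le_max_left _ _

theorem encard_supp_le {z : X} {B : Finset ℕ} (h : ∀ n ∉ B, b.coord n z = 0) :
    (b.supp z).encard ≤ B.card := by
  rw [← Set.encard_coe_eq_coe_finsetCard]
  exact Set.encard_le_encard fun n hn => by_contra fun hB => hn (h n hB)

theorem GreedyWith.almostGreedyWith {C : ℝ} (hC : b.GreedyWith q C) : b.AlmostGreedyWith q C :=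
  fun f A B hA hBA => hC f (b.proj B f) A hA <|
    (encard_supp_le fun n hn => by rw [coord_proj, if_neg hn]).trans (by exact_mod_cast hBA)

theorem IsGreedy.isAlmostGreedy (h : b.IsGreedy q) : b.IsAlmostGreedy q := by
  obtain ⟨h1, h2, C, hC⟩ := h
  exact ⟨h1, h2, C, hC.almostGreedyWith⟩

/-- Greedy bases are suppression unconditional. -/
theorem GreedyWith.sub_proj_le {a : ℝ} (hab : b.CoordBounded q a) (htot : b.IsTotal) {C : ℝ}
    (hC : b.GreedyWith q C) (f : X) (B : Finset ℕ) : q (f - b.proj B f) ≤ C * q f := by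
  -- The value `a * q f` dominates every coordinate of `f`, so `B` becomes greedy once `s` replaces
  -- `S_B(f)`. Approximating by `s - S_B(f)` leaves exactly `f`.
  let s : X := ∑ n ∈ B, ((a * q f : ℝ) : 𝕜) • b.vec n
  have hs : ∀ k, b.coord k s = if k ∈ B then ((a * q f : ℝ) : 𝕜) else 0 := fun k =>
    b.coord_sum B _ k
  have h1 : b.IsGreedySet (f - b.proj B f + s) B := fun n hn k hk => by
    rw [Finset.mem_coe] at hn hk
    rw [map_add, map_add, coord_sub_proj, coord_sub_proj, hs, hs, if_neg hk, if_neg hk, if_pos hn,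
      if_pos hn, zero_add, add_zero, RCLike.norm_ofReal]
    exact (hab k f).trans (le_abs_self _)
  have h2 := hC _ (s - b.proj B f) B h1 (encard_supp_le fun n hn => by
    rw [map_sub, hs, coord_proj, if_neg hn, if_neg hn, sub_zero])
  have h3 : b.proj B (f - b.proj B f + s) = s := htot.ext fun k => by
    rw [coord_proj, map_add, coord_sub_proj, hs]
    split_ifs <;> simp
  have h4 : f - b.proj B f + s - (s - b.proj B f) = f := by abel
  rwa [h3, add_sub_cancel_right, h4] at h2

theorem GreedyWith.exists_sum_mul_le (hq : IsQuasiNorm 𝕜 q) {a : ℝ} (hab : b.CoordBounded q a)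
    (htot : b.IsTotal) {C : ℝ} (hC0 : 1 ≤ C) (hC : b.GreedyWith q C) :
    ∃ V : ℝ, 1 ≤ V ∧ ∀ (f : X) (B : Finset ℕ) (c : ℕ → 𝕜), (∀ n ∈ B, ‖c n‖ ≤ 1) →
      q (∑ n ∈ B, (c n * b.coord n f) • b.vec n) ≤ V * q f := by
  obtain ⟨κ, hκ, h⟩ := hq.add_le
  obtain ⟨K, hK, hKs⟩ := hq.exists_ball_bound
  refine ⟨K * (κ * (1 + C)), one_le_mul_of_one_le_of_one_le hK
    (one_le_mul_of_one_le_of_one_le hκ (by linarith)), fun f B c hc => ?_⟩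
  have := hKs B (fun n => b.coord n f • b.vec n) (κ * (1 + C) * q f) (fun A _ => ?_) c hc
  · simpa [smul_smul, mul_assoc] using this
  · calc q (b.proj A f) = q (f - (f - b.proj A f)) := by simp
      _ ≤ κ * (q f + C * q f) :=
        (hq.sub_le h _ _).trans (by gcongr; exact hC.sub_proj_le hab htot f A)
      _ = _ := by ring

/-- Greedy bases are lattice unconditional. -/
theorem GreedyWith.exists_le_of_dominated [IsTopologicalAddGroup X] (hq : IsQuasiNorm 𝕜 q)
    (hqX : InducesTopology q) {a : ℝ} (hab : b.CoordBounded q a)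
    (htot : b.IsTotal) {C : ℝ} (hC0 : 1 ≤ C) (hC : b.GreedyWith q C) :
    ∃ L : ℝ, 1 ≤ L ∧ ∀ f h : X, (∀ n, ‖b.coord n h‖ ≤ ‖b.coord n f‖) → q h ≤ L * q f := by
  obtain ⟨κ, hκ, hadd⟩ := hq.add_le
  obtain ⟨V, hV, hVs⟩ := hC.exists_sum_mul_le hq hab htot hC0
  refine ⟨κ * V, one_le_mul_of_one_le_of_one_le hκ hV, fun f h hle =>
    le_of_forall_pos_le_add fun ε hε => ?_⟩
  obtain ⟨g, B, h1, h2, -⟩ := b.exists_approx hqX h (ε := ε / (κ * C)) (by positivity)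
  rw [lt_div_iff₀ (by positivity)] at h1
  -- Subtracting `g`, supported in `B`, does not change the tail, so the tail of `h` is small.
  have h3 : h - b.proj B h = (h - g) - b.proj B (h - g) := by
    rw [proj_sub, h2]
    abel
  have h4 : b.proj B h =
      ∑ n ∈ B, (b.coord n h / b.coord n f * b.coord n f) • b.vec n := by
    refine Finset.sum_congr rfl fun n _ => ?_
    by_cases h0 : b.coord n f = 0
    · have : b.coord n h = 0 := by simpa [h0] using hle n
      simp [this]
    · rw [div_mul_cancel₀ _ h0]
  have h5 : q (b.proj B h) ≤ V * q f := by
    rw [h4]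
    refine hVs f B _ fun n _ => ?_
    rw [norm_div]
    exact div_le_one_of_le₀ (hle n) (norm_nonneg _)
  calc q h = q (b.proj B h + (h - b.proj B h)) := by simp
    _ ≤ κ * (V * q f + C * q (h - g)) := by
      refine (hadd _ _).trans ?_
      gcongr
      rw [h3]
      exact hC.sub_proj_le hab htot _ B
    _ = κ * V * q f + q (h - g) * (κ * C) := by ring
    _ ≤ _ := by gcongr

/-- A greedy basis is isometrically lattice unconditional under an equivalent quasi-norm. -/
theorem GreedyWith.exists_lattice_renorming [IsTopologicalAddGroup X] (hq : IsQuasiNorm 𝕜 q)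
    (hqX : InducesTopology q) {a : ℝ} (hab : b.CoordBounded q a)
    (htot : b.IsTotal) {C : ℝ} (hC0 : 1 ≤ C) (hC : b.GreedyWith q C) :
    ∃ (q₁ : X → ℝ) (L : ℝ), IsRenorming 𝕜 q₁ ∧ 0 < L ∧ (∀ f, q f ≤ q₁ f) ∧
      (∀ f, q₁ f ≤ L * q f) ∧
      ∀ f h : X, (∀ n, ‖b.coord n h‖ ≤ ‖b.coord n f‖) → q₁ h ≤ q₁ f := by
  obtain ⟨L, hL, hLs⟩ := hC.exists_le_of_dominated hq hqX hab htot hC0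
  let S : X → Set ℝ := fun f => {r | ∃ h, (∀ n, ‖b.coord n h‖ ≤ ‖b.coord n f‖) ∧ r = q h}
  let q₁ : X → ℝ := fun f => sSup (S f)
  have hbdd : ∀ f, BddAbove (S f) := fun f =>
    ⟨L * q f, by rintro _ ⟨g, hg, rfl⟩; exact hLs f g hg⟩
  have hne : ∀ f, (S f).Nonempty := fun f => ⟨_, f, fun _ => le_rfl, rfl⟩
  have hle : ∀ f, q f ≤ q₁ f := fun f => le_csSup (hbdd f) ⟨f, fun _ => le_rfl, rfl⟩
  have hge : ∀ f, q₁ f ≤ L * q f := fun f =>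
    csSup_le (hne f) (by rintro _ ⟨g, hg, rfl⟩; exact hLs f g hg)
  have hsmul : ∀ (t : 𝕜) f, q₁ (t • f) = ‖t‖ * q₁ f := by
    refine map_smul_eq_of_map_smul_le (fun f => (hq.nonneg f).trans (hle f)) fun t f => ?_
    rcases eq_or_ne t 0 with rfl | ht
    · simpa [hq.map_zero] using hge 0
    refine csSup_le (hne _) ?_
    rintro _ ⟨g, hg, rfl⟩
    have h2 : q (t⁻¹ • g) ≤ q₁ f := le_csSup (hbdd f) ⟨_, fun n => ?_, rfl⟩
    · rwa [hq.smul, norm_inv, inv_mul_le_iff₀ (norm_pos_iff.2 ht)] at h2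
    · have := hg n
      rw [map_smul, norm_smul] at this
      rwa [map_smul, norm_smul, norm_inv, inv_mul_le_iff₀ (norm_pos_iff.2 ht)]
  refine ⟨q₁, L, hq.isRenorming_of_equiv hqX hsmul (by linarith : 0 < L) one_pos hge
    (fun f => by simpa using hle f), by linarith, hle, hge, fun f h hfh => ?_⟩
  refine csSup_le_csSup (hbdd f) (hne h) ?_
  rintro _ ⟨g, hg, rfl⟩
  exact ⟨g, fun n => (hg n).trans (hfh n), rfl⟩

/-- Keep `z` and remove only the part of `D` inside the support of `h`: domination is inherited by
the replaced vectors. -/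
theorem almostGreedyNorm_le_of_dominated (hq : IsQuasiNorm 𝕜 q)
    (hmono : ∀ f h : X, (∀ n, ‖b.coord n h‖ ≤ ‖b.coord n f‖) → q h ≤ q f) {f h : X}
    (hfh : ∀ n, ‖b.coord n h‖ ≤ ‖b.coord n f‖) :
    b.almostGreedyNorm q h ≤ b.almostGreedyNorm q f := by
  have hz : ∀ n, b.coord n f = 0 → b.coord n h = 0 := fun n hn => by simpa [hn] using hfh n
  refine almostGreedyNorm_mono hq fun D z hD => ?_
  have hcoord := coord_replacement hD
  rw [mem_replacements] at hD
  obtain ⟨d1, d2, d3, d4⟩ := hD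
  have hmem : (D.filter (fun n => b.coord n h ≠ 0), z) ∈ b.replacements h := by
    refine mem_replacements.2 ⟨fun n hn => (Finset.mem_filter.1 hn).2, fun n hn hn' => ?_, ?_,
      fun n m hm => (hfh n).trans (d4 n m hm)⟩
    · exact d2 n (fun h0 => hn (hz n h0)) fun hnD => hn' (Finset.mem_filter.2 ⟨hnD, hn⟩)
    · exact le_trans (by exact_mod_cast Finset.card_filter_le _ _) d3
  refine ⟨_, z, hmem, hmono _ _ fun n => ?_⟩
  obtain ⟨n1, n2, n3⟩ := hcoord n
  obtain ⟨m1, m2, m3⟩ := coord_replacement hmem n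
  by_cases h0 : b.coord n z = 0
  · by_cases hnD : n ∈ D
    · by_cases hnh : b.coord n h = 0
      · rw [m2 (by simp [hnh]) h0, hnh]
        simp
      · rw [m3 (Finset.mem_filter.2 ⟨hnD, hnh⟩) h0]
        simp
    · rw [m2 (by simp [hnD]) h0, n2 hnD h0]
      exact hfh n
  · rw [n1 h0, m1 h0]

/-- Both sides are continuous in `f` and agree on the dense span. -/
theorem IsMultiplier.coord_apply {γ : ℕ → 𝕜} {T : X →L[𝕜] X} (hT : b.IsMultiplier γ T) (n : ℕ)
    (f : X) : b.coord n (T f) = γ n * b.coord n f := by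
  have h1 : Continuous fun f => b.coord n (T f) := (b.coord n).continuous.comp T.continuous
  have h2 : Continuous fun f => γ n * b.coord n f := continuous_const.mul (b.coord n).continuous
  refine congrFun (h1.ext_on b.dense_span h2 fun g hg => ?_) f
  induction hg using Submodule.span_induction with
  | mem x hx =>
    obtain ⟨k, rfl⟩ := hx
    simp only [hT k, map_smul, coord_vec]
    split_ifs with h
    · simp [h]
    · simp
  | zero => simp
  | add x y _ _ hx hy => simp only [map_add, mul_add, hx, hy]
  | smul c x _ hx =>
    simp only [map_smul, hx, smul_eq_mul]
    ring

end

/-! ### Multipliers on complete spaces and the greedy renorming -/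

section Complete

variable {𝕜 : Type*} [RCLike 𝕜] {X : Type*} [AddCommGroup X] [Module 𝕜 X] [UniformSpace X]
  [IsUniformAddGroup X] [CompleteSpace X] {b : CompleteMBasis 𝕜 X} {q : X → ℝ}

/-- The multiplied series is unconditionally Cauchy: off the support of an approximant `g`, its
terms are those of the small vector `f - g`, and finite multipliers are uniformly bounded.
Completeness supplies the sum. -/
theorem GreedyWith.exists_coord_eq_mul (hq : IsQuasiNorm 𝕜 q) (hqX : InducesTopology q) {a : ℝ}
    (hab : b.CoordBounded q a) (htot : b.IsTotal) {C : ℝ} (hC0 : 1 ≤ C) (hC : b.GreedyWith q C)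
    {γ : ℕ → 𝕜} {M : ℝ} (hM : 0 < M) (hγ : ∀ n, ‖γ n‖ ≤ M) (f : X) :
    ∃ h : X, ∀ n, b.coord n h = γ n * b.coord n f := by
  obtain ⟨V, hV, hVs⟩ := hC.exists_sum_mul_le hq hab htot hC0
  have hs : Summable fun n => (γ n * b.coord n f) • b.vec n := by
    rw [summable_iff_vanishing]
    intro e he
    obtain ⟨ε, hε, hεe⟩ := hqX.mem_iff.1 he
    obtain ⟨g, A, h1, -, h3⟩ := b.exists_approx hqX f (ε := ε / (M * V)) (by positivity)
    rw [lt_div_iff₀ (by positivity)] at h1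
    refine ⟨A, fun t ht => hεe ?_⟩
    have h4 : ∑ n ∈ t, (γ n * b.coord n f) • b.vec n =
        (M : 𝕜) • ∑ n ∈ t, (γ n / (M : 𝕜) * b.coord n (f - g)) • b.vec n := by
      rw [Finset.smul_sum]
      refine Finset.sum_congr rfl fun n hn => ?_
      have hM' : (M : 𝕜) ≠ 0 := by exact_mod_cast hM.ne'
      rw [map_sub, h3 n (Finset.disjoint_left.1 ht hn), sub_zero, smul_smul]
      congr 1
      field_simp
    have h5 : q (∑ n ∈ t, (γ n * b.coord n f) • b.vec n) < ε := by
      rw [h4, hq.map_real_smul hM.le]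
      calc _ ≤ M * (V * q (f - g)) := by
            gcongr
            refine hVs (f - g) t (fun n => γ n / (M : 𝕜)) fun n _ => ?_
            rw [norm_div, RCLike.norm_ofReal, abs_of_pos hM]
            exact div_le_one_of_le₀ (hγ n) hM.le
        _ < ε := by linarith
    exact h5
  refine ⟨∑' n, (γ n * b.coord n f) • b.vec n, fun n => ?_⟩
  rw [(b.coord n).map_tsum hs, tsum_eq_single n]
  · simp [coord_vec]
  · intro k hk
    simp [coord_vec, hk]

theorem GreedyWith.exists_isMultiplier (hq : IsQuasiNorm 𝕜 q) (hqX : InducesTopology q) {a : ℝ}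
    (hab : b.CoordBounded q a) (htot : b.IsTotal) {C : ℝ} (hC0 : 1 ≤ C) (hC : b.GreedyWith q C)
    {γ : ℕ → 𝕜} {M : ℝ} (hγ : ∀ n, ‖γ n‖ ≤ M) : ∃ T : X →L[𝕜] X, b.IsMultiplier γ T := by
  have hM : 0 < max M 1 := by positivity
  replace hγ : ∀ n, ‖γ n‖ ≤ max M 1 := fun n => (hγ n).trans (le_max_left _ _)
  choose T hT using hC.exists_coord_eq_mul hq hqX hab htot hC0 hM hγ
  obtain ⟨L, hL, hLs⟩ := hC.exists_le_of_dominated hq hqX hab htot hC0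
  let T' : X →ₗ[𝕜] X :=
    { toFun := T
      map_add' := fun f g => htot.ext fun n => by
        rw [map_add, hT, hT, hT, map_add, mul_add]
      map_smul' := fun c f => htot.ext fun n => by
        rw [map_smul, hT, hT, map_smul, RingHom.id_apply, smul_eq_mul, smul_eq_mul]
        ring }
  have hbound : ∀ f, q (T' f) ≤ L * (max M 1 * q f) := fun f => by
    rw [← hq.map_real_smul (𝕜 := 𝕜) hM.le]
    refine hLs _ _ fun n => ?_
    rw [map_smul, norm_smul, RCLike.norm_ofReal, abs_of_pos hM]
    change ‖b.coord n (T f)‖ ≤ _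
    rw [hT, norm_mul]
    gcongr
    exact hγ n
  have hcont : Continuous T' := by
    refine continuous_of_continuousAt_zero T' ?_
    rw [ContinuousAt, map_zero, hqX.tendsto_iff hqX]
    refine fun ε hε => ⟨ε / (L * max M 1), by positivity, fun f hf => ?_⟩
    have hf' : q f < ε / (L * max M 1) := hf
    rw [lt_div_iff₀ (by positivity)] at hf'
    exact (hbound f).trans_lt (by linarith)
  refine ⟨⟨T', hcont⟩, fun k => htot.ext fun n => ?_⟩
  change b.coord n (T (b.vec k)) = _
  rw [hT, map_smul, coord_vec]
  split_ifs with h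
  · simp [h]
  · simp

/-- A greedy basis is isometrically greedy and isometrically lattice unconditional under an
equivalent quasi-norm. -/
theorem IsGreedy.exists_renorming (hq : IsQuasiNorm 𝕜 q) (hqX : InducesTopology q)
    (hb : b.IsGreedy q) :
    ∃ q₀ : X → ℝ, IsRenorming 𝕜 q₀ ∧ b.IsGreedyConst q₀ 1 ∧
      b.IsLatticeUnconditionalConst q₀ 1 := by
  obtain ⟨a, ha, hab⟩ := b.exists_coordBounded hq hb.1 hb.2.1
  obtain ⟨C, hC0, hC⟩ := hb.exists_greedyWith hq
  obtain ⟨Q, hQ0, hQ⟩ := hC.almostGreedyWith.exists_quasiGreedyWith hq hC0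
  have htot := hQ.isTotal hq hqX (by linarith)
  obtain ⟨q₁, L, hren, hL, hle, hge, hmono⟩ := hC.exists_lattice_renorming hq hqX hab htot hC0
  obtain ⟨hren₀, hAG, -⟩ := (hb.isAlmostGreedy.of_equiv hq hL hle hge).almostGreedyNorm_spec
    hren.1 hren.2
  have hdom := @almostGreedyNorm_le_of_dominated _ _ _ _ _ _ b _ hren.1 hmono
  refine ⟨b.almostGreedyNorm q₁, hren₀, isGreedyConst_one hren₀.1 fun f z A hA hz => ?_,
    fun γ ⟨M, hM⟩ => hC.exists_isMultiplier hq hqX hab htot hC0 hM, ?_, fun r hr => ?_⟩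
  · have hfin : (b.supp z).Finite := Set.finite_of_encard_le_coe hz
    obtain ⟨Z, hZ⟩ := hfin.exists_finset_coe
    rw [← hZ, Set.encard_coe_eq_coe_finsetCard] at hz
    refine (hAG.1 f A Z hA (by exact_mod_cast hz)).trans ?_
    gcongr
    -- Off `Z` the vectors `f - S_Z(f)` and `f - z` have the same coordinates, and on `Z` the former
    -- vanishes.
    refine hdom fun n => ?_
    rw [coord_sub_proj]
    split_ifs with hn
    · simp
    · have : b.coord n z = 0 := by
        by_contra h
        have h' : n ∈ b.supp z := h
        rw [← hZ] at h'
        exact hn h'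
      rw [map_sub, this, sub_zero]
  · rintro _ ⟨γ, T, f, hγ, hT, hf, rfl⟩
    refine (hdom fun n => ?_).trans hf
    rw [hT.coord_apply, norm_mul]
    exact mul_le_of_le_one_left (norm_nonneg _) (hγ n)
  · obtain ⟨f, h1, -⟩ := hren₀.1.exists_normalized b
    exact hr ⟨1, ContinuousLinearMap.id 𝕜 X, f, by simp, fun n => by simp, h1.le, by simp [h1]⟩

end Complete

end CompleteMBasis

theorem mainTheorem6 {𝕜 : Type*} [RCLike 𝕜] {X : Type*} [AddCommGroup X] [Module 𝕜 X]
    [UniformSpace X] [IsUniformAddGroup X] [CompleteSpace X]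
    (q : X → ℝ) (hq : IsQuasiNorm 𝕜 q) (hqX : InducesTopology q) (b : CompleteMBasis 𝕜 X) :
    (b.IsQuasiGreedy q →
      ∃ q₀ : X → ℝ, IsRenorming 𝕜 q₀ ∧ b.IsQuasiGreedyConst q₀ 1 ∧
        b.IsTruncationConst q₀ 1 ∧ b.IsRestrictedTruncationConst q₀ 1) ∧
    (b.IsAlmostGreedy q →
      IsRenorming 𝕜 (b.almostGreedyNorm q) ∧
        b.IsAlmostGreedyConst (b.almostGreedyNorm q) 1 ∧
        b.IsTruncationConst (b.almostGreedyNorm q) 1 ∧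
        (b.IsQuasiGreedyConst q 1 →
          b.IsQuasiGreedyConst (b.almostGreedyNorm q) 1 ∧
          b.IsRestrictedTruncationConst (b.almostGreedyNorm q) 1)) ∧
    (b.IsAlmostGreedy q →
      ∃ q₀ : X → ℝ, IsRenorming 𝕜 q₀ ∧ b.IsQuasiGreedyConst q₀ 1 ∧
        b.IsAlmostGreedyConst q₀ 1 ∧ b.IsRestrictedTruncationConst q₀ 1 ∧
        b.IsTruncationConst q₀ 1) ∧
    (b.IsGreedy q →
      ∃ q₀ : X → ℝ, IsRenorming 𝕜 q₀ ∧ b.IsGreedyConst q₀ 1 ∧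
        b.IsLatticeUnconditionalConst q₀ 1) := by
  refine ⟨fun h => ?_, fun h => h.almostGreedyNorm_spec hq hqX, fun h => ?_,
    fun h => h.exists_renorming hq hqX⟩
  · obtain ⟨q₀, K, h1, -, -, -, h2⟩ := h.exists_renorming hq hqX
    exact ⟨q₀, h1, h2⟩
  -- The order matters: `C_qg = 1` is arranged first, and `almostGreedyNorm` then preserves it.
  · obtain ⟨q₀, K, hren, hK, hle, hge, hqg, -⟩ := (h.isQuasiGreedy hq).exists_renorming hq hqX
    obtain ⟨h1, h2, h3, h4⟩ := (h.of_equiv hq hK hle hge).almostGreedyNorm_spec hren.1 hren.2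
    exact ⟨_, h1, (h4 hqg).1, h2, (h4 hqg).2, h3⟩
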